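/- Let $F$ be a field of characteristic not $2$. A quaternion algebra over $F$ is an $F$-algebra isomorphic to $\left(\frac{a,b}{F}\right)$ for some $a,b\in F^\times$; its norm form is $q_D=\langle 1,-a,-b,ab\rangle$. Two quaternion division algebras over the same field are called linked if they share a common maximal subfield (up to isomorphism over the base field), and isometric if their norm forms are isometric (equivalently, if they are isomorphic). There exists a field extension $L/F$ such that 1. $L/F$ is a linking extension: if $D,D'$ are quaternion division algebras over $F$ such that $D\otimes_F L$ and $D'\otimes_F L$ are division algebras, then $D\otimes_F L$ and $D'\otimes_F L$ are linked; 2. if $D,D'$ are linked, nonisometric quaternion division algebras over $F$, then $D\otimes_F L$ and $D'\otimes_F L$ are nonisometric quaternion division algebras over $L$; 3. $L$ is a transfinite tower of function fields: let $\mathscr P$ be the set of pairs $p=(D,D')$ of (isomorphism classes of) unlinked quaternion division algebras over $F$. For each $p=(D,D')\in\mathscr P$ the anisotropic part $\varphi_p$ of $q_D\perp -q_{D'}$ has dimension $6$, and there are a well-ordering $<$ of $\mathscr P$ and intermediate fields $F\subseteq F_p\subseteq L$ $(p\in\mathscr P)$ such that, with $F_{<p}:=F\cup\bigcup_{p'<p}F_{p'}$,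 the field $F_p$ contains $F_{<p}$ and is isomorphic over it to $\mathrm{Frac}\big(F_{<p}[x_1,\dots,x_6]/(\varphi_p)\big)$, and $L=F\cup\bigcup_{p\in\mathscr P}F_p$. -/

import Mathlib

open scoped Quaternion TensorProduct

universe u v

namespace Linking

section Algebras

variable (F : Type u) [Field F]

/-- The algebra `D` is represented by the Hilbert symbol `(a, b / F)`: it is the `F`-algebra with
basis `1, i, j, ij` and `i ^ 2 = a`, `j ^ 2 = b`, `ij = -ji`, where `a, b ≠ 0`. -/
def HasSymbol (D : Type v) [Ring D] [Algebra F D] (a b : Fˣ) : Prop :=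
  Nonempty (D ≃ₐ[F] ℍ[F, (a : F), 0, (b : F)])

/-- `D` is a quaternion algebra with center `F` (for `F` of characteristic not two). -/
def IsQuaternion (D : Type v) [Ring D] [Algebra F D] : Prop :=
  ∃ a b : Fˣ, HasSymbol F D a b

/-- `D` is a quaternion division algebra with center `F`. -/
def IsQuaternionDivision (D : Type v) [Ring D] [Algebra F D] : Prop :=
  IsQuaternion F D ∧ ∀ x : D, x ≠ 0 → IsUnit x

/-- `E` is a maximal element among the fields `E` with `F ⊆ E ⊆ D`. -/
def IsMaximalSubfield {D : Type v} [Ring D] [Algebra F D] (E : Subalgebra F D) : Prop :=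
  Maximal (fun S : Subalgebra F D => IsField S) E

/-- `D` and `D'` share a common maximal subfield (up to `F`-isomorphism). -/
def Linked (D D' : Type v) [Ring D] [Algebra F D] [Ring D'] [Algebra F D'] : Prop :=
  ∃ (E : Subalgebra F D) (E' : Subalgebra F D'),
    IsMaximalSubfield F E ∧ IsMaximalSubfield F E' ∧ Nonempty (E ≃ₐ[F] E')

variable {F} in
/-- The norm form `⟨1, -a⟩ ⊗ ⟨1, -b⟩ = ⟨1, -a, -b, ab⟩` of the quaternion algebra `(a, b / F)`. -/
noncomputable def normForm (a b : Fˣ) : QuadraticForm F (Fin 4 → F) :=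
  QuadraticMap.weightedSumSquares F ![(1 : F), -(a : F), -(b : F), (a : F) * (b : F)]

/-- The quaternion algebras `D` and `D'` have isometric norm forms. -/
def Isometric (D D' : Type v) [Ring D] [Algebra F D] [Ring D'] [Algebra F D'] : Prop :=
  ∃ a b a' b' : Fˣ, HasSymbol F D a b ∧ HasSymbol F D' a' b' ∧
    (normForm a b).Equivalent (normForm a' b')

/-- `L / F` is a linking extension: all division algebras among the `L ⊗ D`, for `D` a quaternion
division algebra with center `F`, are pairwise linked. -/
def IsLinkingExtension (L : Type u) [Field L] [Algebra F L] : Prop :=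
  ∀ (D D' : Type u) [Ring D] [Algebra F D] [Ring D'] [Algebra F D'],
    IsQuaternionDivision F D → IsQuaternionDivision F D' →
    IsQuaternionDivision L (L ⊗[F] D) → IsQuaternionDivision L (L ⊗[F] D') →
    Linked L (L ⊗[F] D) (L ⊗[F] D')

end Algebras

section Classes

variable (F : Type u) [Field F]

/-- Two Hilbert symbols are identified if their quaternion algebras are isomorphic. -/
def symbolSetoid : Setoid (Fˣ × Fˣ) where
  r s t := HasSymbol F ℍ[F, (s.1 : F), 0, (s.2 : F)] t.1 t.2
  iseqv :=
    { refl := fun _ => ⟨AlgEquiv.refl⟩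
      symm := fun ⟨e⟩ => ⟨e.symm⟩
      trans := fun ⟨e⟩ ⟨e'⟩ => ⟨e.trans e'⟩ }

/-- The set of isomorphism classes of quaternion algebras with center `F`. -/
def Quat : Type u := Quotient (symbolSetoid F)

variable {F}

/-- A Hilbert symbol representing the isomorphism class `D`. -/
noncomputable def Quat.symbol (D : Quat F) : Fˣ × Fˣ := Quotient.out D

/-- A quaternion algebra in the isomorphism class `D`. -/
abbrev Quat.Alg (D : Quat F) : Type u :=
  ℍ[F, (D.symbol.1 : F), 0, (D.symbol.2 : F)]

/-- The norm form of the isomorphism class `D`. -/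
noncomputable def Quat.form (D : Quat F) : QuadraticForm F (Fin 4 → F) :=
  normForm D.symbol.1 D.symbol.2

variable (F) in
/-- The set of pairs of unlinked (isomorphism classes of) quaternion division algebras. -/
def UnlinkedPair : Type u :=
  {p : Quat F × Quat F // IsQuaternionDivision F p.1.Alg ∧ IsQuaternionDivision F p.2.Alg ∧
    ¬ Linked F p.1.Alg p.2.Alg}

/-- The 6-dimensional form `φ` is the anisotropic part of `q_D - q_D'`: it is anisotropic, and
`q_D ⊥ -q_D'` is isometric to the sum of `φ` and a hyperbolic plane `⟨1, -1⟩`. -/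
def IsAnisotropicPart (D D' : Quat F) (φ : QuadraticForm F (Fin 6 → F)) : Prop :=
  φ.Anisotropic ∧
    (QuadraticMap.prod D.form (-D'.form)).Equivalent
      (QuadraticMap.prod φ (QuadraticMap.weightedSumSquares F ![(1 : F), -1]))

end Classes

section FunctionFields

variable {F : Type u} [Field F]

/-- The quadratic form `φ` as a homogeneous polynomial of degree two. -/
noncomputable def formPolynomial {r : ℕ} (φ : QuadraticForm F (Fin r → F)) :
    MvPolynomial (Fin r) F :=
  ∑ i, MvPolynomial.C (φ (Pi.single i 1)) * MvPolynomial.X i ^ 2 +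
    ∑ i, ∑ j ∈ Finset.Ioi i,
      MvPolynomial.C (QuadraticMap.polar φ (Pi.single i 1) (Pi.single j 1)) *
        (MvPolynomial.X i * MvPolynomial.X j)

/-- The "big" function field `K[φ] = Frac (K[x₁, …, x_r] / (φ))` over an extension `K` of `F`. -/
abbrev BigFunctionField (K : Type u) [Field K] [Algebra F K] {r : ℕ}
    (φ : QuadraticForm F (Fin r → F)) : Type u :=
  FractionRing (MvPolynomial (Fin r) K ⧸
    Ideal.span {MvPolynomial.map (algebraMap F K) (formPolynomial φ)})

/-- `L` is the union of a tower of fields `F_p` between `F` and `L`, indexed by the well-ordered set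
of unlinked pairs `p = (D, D')`, in which `F_p` is the function field, over the union of the `F_p'`
with `p' < p` (over `F`, if `p` is the least pair), of the 6-dimensional anisotropic part `φ_p` of
`q_D - q_D'`. The suprema are unions, as the `F_p` form a chain; if there are no unlinked pairs,
then `L = F`. -/
def IsFunctionFieldTower (F L : Type u) [Field F] [Field L] [Algebra F L] : Prop :=
  ∃ (lt : UnlinkedPair F → UnlinkedPair F → Prop)
    (φ : UnlinkedPair F → QuadraticForm F (Fin 6 → F))
    (K : UnlinkedPair F → IntermediateField F L),
    IsWellOrder (UnlinkedPair F) lt ∧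
    (∀ p, IsAnisotropicPart p.1.1 p.1.2 (φ p)) ∧
    (∀ p, ∃ h : (⨆ p' : {p' // lt p' p}, K p'.1) ≤ K p,
      Nonempty (IntermediateField.extendScalars h ≃ₐ[↥(⨆ p' : {p' // lt p' p}, K p'.1)]
        BigFunctionField ↥(⨆ p' : {p' // lt p' p}, K p'.1) (φ p))) ∧
    (⨆ p, K p) = ⊤

end FunctionFields

end Linking

/-! The field `L` is generated over `F` by one generic zero of the Albert form φ_p, the pure part of
q_D minus the pure part of q_D', for every unlinked pair p. Concretely, algebraically independent
t_{p,i} and a square root y_p for each p are chosen in one algebraic closure. A nontrivial zero of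
φ_p is a pair of pure quaternions of equal norm, hence of equal square, and these generate
isomorphic quadratic subfields (`linked_of_nrd_eq`). Pairs already linked over `F` have a common
slot, which survives base change. After well-ordering the pairs, the fields generated by the zeros
with index at most p form the tower; each step is a function field by `Aniso.ker_aeval_cons`.

For the second property, write D = (α, β) and D' = (α, γ). These are isometric exactly when (α, βγ)
is not division (`isometric_of_not_aniso`, `not_aniso_of_isometry`). So it suffices that every
quaternion division algebra over `F` stays division over `L` (`GenericZeros.aniso`). As finitely
many elements of `L` involve finitely many zeros, it is enough to adjoin one zero of a diagonal form
in n + 1 ≥ 5 variables (`Aniso.adjoin_cons`).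

Such a step from K is K(t₁, …, tₙ)(√s) with s = ∑ dᵢtᵢ². If a division algebra Q became split there,
Q over K(t) would contain a square root β of s. Left multiplication by β stabilizes a nonzero right
ideal of Q[t₁] over the remaining rational function field, and this ideal is principal, so β is
conjugate to a polynomial A + Bt₁ (`Aniso.exists_conj`). Comparing coefficients, B² = d₁, A² is the
rest of s, and A, B anticommute (`HasFamily.descend`). Removing all variables leaves n pairwise
anticommuting elements of Q with nonzero squares in K, which is impossible for n ≥ 4
(`Aniso.not_hasFamily`). -/

namespace Linking

/-! ### Reduced norms and change of the base ring. -/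

section Basic

variable {R S : Type*} [CommRing R] [CommRing S]

/-- The reduced norm of the quaternion algebra `(a, b / R)`. -/
def nrd {a b : R} (q : ℍ[R, a, 0, b]) : R :=
  q.re ^ 2 - a * q.imI ^ 2 - b * q.imJ ^ 2 + a * b * q.imK ^ 2

/-- The reduced norm of `(a, b / R)` has no nontrivial zero. -/
def Aniso (a b : R) : Prop := ∀ q : ℍ[R, a, 0, b], nrd q = 0 → q = 0

variable {a b : R} {a' b' : S}

theorem nrd_mul (p q : ℍ[R, a, 0, b]) : nrd (p * q) = nrd p * nrd q := by
  simp only [nrd, QuaternionAlgebra.re_mul, QuaternionAlgebra.imI_mul, QuaternionAlgebra.imJ_mul,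
    QuaternionAlgebra.imK_mul]
  ring

theorem nrd_star (q : ℍ[R, a, 0, b]) : nrd (star q) = nrd q := by
  simp [nrd]

@[simp]
theorem nrd_zero : nrd (0 : ℍ[R, a, 0, b]) = 0 := by simp [nrd]

@[simp]
theorem nrd_one : nrd (1 : ℍ[R, a, 0, b]) = 1 := by simp [nrd]

theorem nrd_algebraMap (r : R) : nrd (algebraMap R ℍ[R, a, 0, b] r) = r ^ 2 := by
  simp [nrd, QuaternionAlgebra.algebraMap_eq]

theorem mul_star_eq_nrd (q : ℍ[R, a, 0, b]) : q * star q = algebraMap R _ (nrd q) := by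
  ext <;> simp [nrd, QuaternionAlgebra.algebraMap_eq] <;> ring

theorem star_mul_eq_nrd (q : ℍ[R, a, 0, b]) : star q * q = algebraMap R _ (nrd q) := by
  ext <;> simp [nrd, QuaternionAlgebra.algebraMap_eq] <;> ring

theorem mul_self_of_re_eq_zero {q : ℍ[R, a, 0, b]} (h : q.re = 0) :
    q * q = algebraMap R _ (-nrd q) := by
  ext <;> simp [nrd, QuaternionAlgebra.algebraMap_eq, h] <;> ring

theorem Aniso.mul_eq_zero [IsDomain R] (h : Aniso a b) {p q : ℍ[R, a, 0, b]} (hpq : p * q = 0) :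
    p = 0 ∨ q = 0 := by
  have : nrd p * nrd q = 0 := by rw [← nrd_mul, hpq, nrd_zero]
  exact (_root_.mul_eq_zero.mp this).imp (h p) (h q)

theorem Aniso.mul_left_cancel [IsDomain R] (h : Aniso a b) {g p q : ℍ[R, a, 0, b]} (hg : g ≠ 0)
    (hpq : g * p = g * q) : p = q := by
  have : g * (p - q) = 0 := by rw [mul_sub, hpq, sub_self]
  exact sub_eq_zero.mp ((h.mul_eq_zero this).resolve_left hg)

/-- The map of quaternion algebras induced by a homomorphism of the base rings. -/
def qmap (f : R →+* S) (ha : f a = a') (hb : f b = b') : ℍ[R, a, 0, b] →+* ℍ[S, a', 0, b'] where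
  toFun q := ⟨f q.re, f q.imI, f q.imJ, f q.imK⟩
  map_one' := by ext <;> simp
  map_zero' := by ext <;> simp
  map_add' _ _ := by ext <;> simp
  map_mul' _ _ := by ext <;> simp [ha, hb]

section qmap

variable (f : R →+* S) (ha : f a = a') (hb : f b = b')

@[simp] theorem qmap_re (q : ℍ[R, a, 0, b]) : (qmap f ha hb q).re = f q.re := rfl
@[simp] theorem qmap_imI (q : ℍ[R, a, 0, b]) : (qmap f ha hb q).imI = f q.imI := rfl
@[simp] theorem qmap_imJ (q : ℍ[R, a, 0, b]) : (qmap f ha hb q).imJ = f q.imJ := rfl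
@[simp] theorem qmap_imK (q : ℍ[R, a, 0, b]) : (qmap f ha hb q).imK = f q.imK := rfl

theorem nrd_qmap (q : ℍ[R, a, 0, b]) : nrd (qmap f ha hb q) = f (nrd q) := by
  simp [nrd, ha, hb]

theorem qmap_algebraMap (r : R) :
    qmap f ha hb (algebraMap R _ r) = algebraMap S _ (f r) := by
  ext <;> simp [QuaternionAlgebra.algebraMap_eq]

theorem qmap_injective (hf : Function.Injective f) : Function.Injective (qmap f ha hb) := by
  intro p q h
  have h' := QuaternionAlgebra.ext_iff.mp h
  simp only [qmap_re, qmap_imI, qmap_imJ, qmap_imK] at h'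
  exact QuaternionAlgebra.ext (hf h'.1) (hf h'.2.1) (hf h'.2.2.1) (hf h'.2.2.2)

theorem Aniso.of_map (f : R →+* S) (ha : f a = a') (hb : f b = b')
    (hf : Function.Injective f) (h : Aniso a' b') : Aniso a b := by
  intro q hq
  apply qmap_injective f ha hb hf
  rw [map_zero]
  exact h _ (by rw [nrd_qmap, hq, map_zero])

end qmap

open Classical in
theorem exists_qmap_eq_mul [IsDomain R] {K : Type*} [Field K] [Algebra R K] [IsFractionRing R K]
    {a' b' : K} (ha : algebraMap R K a = a') (hb : algebraMap R K b = b') (q : ℍ[K, a', 0, b']) :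
    ∃ d : R, d ≠ 0 ∧ ∃ p : ℍ[R, a, 0, b],
      qmap (algebraMap R K) ha hb p = q * algebraMap K _ (algebraMap R K d) := by
  obtain ⟨d, hd⟩ := IsLocalization.exist_integer_multiples_of_finset (nonZeroDivisors R)
    ({q.re, q.imI, q.imJ, q.imK} : Finset K)
  simp only [Finset.mem_insert, Finset.mem_singleton, forall_eq_or_imp, forall_eq,
    IsLocalization.IsInteger, Algebra.smul_def, RingHom.mem_rangeS] at hd
  obtain ⟨⟨w, hw⟩, ⟨x, hx⟩, ⟨y, hy⟩, ⟨z, hz⟩⟩ := hd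
  refine ⟨d, nonZeroDivisors.ne_zero d.2, ⟨w, x, y, z⟩, ?_⟩
  ext <;> simp [QuaternionAlgebra.algebraMap_eq, hw, hx, hy, hz, mul_comm]

theorem Aniso.fractionRing [IsDomain R] {K : Type*} [Field K] [Algebra R K] [IsFractionRing R K]
    {a' b' : K} (ha : algebraMap R K a = a') (hb : algebraMap R K b = b') (h : Aniso a b) :
    Aniso a' b' := by
  intro q hq
  obtain ⟨d, hd, p, hp⟩ := exists_qmap_eq_mul ha hb q
  have hinj := IsFractionRing.injective R K
  have h0 : p = 0 := by
    apply h
    apply hinj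
    rw [← nrd_qmap _ ha hb, hp, nrd_mul, hq, zero_mul, map_zero]
  have hd' : algebraMap R K d ≠ 0 := by
    rwa [Ne, map_eq_zero_iff _ hinj]
  have hn : IsUnit (algebraMap K ℍ[K, a', 0, b'] (algebraMap R K d)) :=
    (IsUnit.mk0 _ hd').map (algebraMap K ℍ[K, a', 0, b'])
  rw [h0, map_zero] at hp
  exact hn.mul_left_eq_zero.mp hp.symm

end Basic

/-! ### Polynomials over a quaternion division algebra. -/

section Descent

open Polynomial

variable {k : Type*} [Field k] {a b : k}

theorem natDegree_nrd_le (v : ℍ[k[X], C a, 0, C b]) (m : ℕ) (h0 : v.re.natDegree ≤ m)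
    (h1 : v.imI.natDegree ≤ m) (h2 : v.imJ.natDegree ≤ m) (h3 : v.imK.natDegree ≤ m) :
    (nrd v).natDegree ≤ 2 * m := by
  have key : ∀ (c : k) (p : k[X]), p.natDegree ≤ m → (C c * p ^ 2).natDegree ≤ 2 * m :=
    fun c p hp => (natDegree_C_mul_le _ _).trans (natDegree_pow_le_of_le 2 hp)
  have e : nrd v = C 1 * v.re ^ 2 - C a * v.imI ^ 2 - C b * v.imJ ^ 2 + C (a * b) * v.imK ^ 2 := by
    simp [nrd]
  rw [e]
  exact natDegree_add_le_of_le (natDegree_sub_le_of_le (natDegree_sub_le_of_le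
    (key _ _ h0) (key _ _ h1)) (key _ _ h2)) (key _ _ h3) |>.trans (by simp)

theorem coeff_nrd (v : ℍ[k[X], C a, 0, C b]) (m : ℕ) (h0 : v.re.natDegree ≤ m)
    (h1 : v.imI.natDegree ≤ m) (h2 : v.imJ.natDegree ≤ m) (h3 : v.imK.natDegree ≤ m) :
    (nrd v).coeff (m + m) =
      nrd (⟨v.re.coeff m, v.imI.coeff m, v.imJ.coeff m, v.imK.coeff m⟩ : ℍ[k, a, 0, b]) := by
  have e : nrd v = v.re * v.re - C a * (v.imI * v.imI) - C b * (v.imJ * v.imJ) +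
      C (a * b) * (v.imK * v.imK) := by
    simp [nrd, sq]
  rw [e]
  simp only [coeff_add, coeff_sub, coeff_C_mul, coeff_mul_add_eq_of_natDegree_le h0 h0,
    coeff_mul_add_eq_of_natDegree_le h1 h1, coeff_mul_add_eq_of_natDegree_le h2 h2,
    coeff_mul_add_eq_of_natDegree_le h3 h3, nrd]
  ring

/-- Leading terms cannot cancel in the norm: its coefficient in twice the top degree is the norm of
the nonzero quaternion of top coefficients. -/
theorem Aniso.natDegree_le (h : Aniso a b) (v : ℍ[k[X], C a, 0, C b]) (m : ℕ)
    (hm : (nrd v).natDegree ≤ 2 * m) : v.re.natDegree ≤ m ∧ v.imI.natDegree ≤ m ∧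
      v.imJ.natDegree ≤ m ∧ v.imK.natDegree ≤ m := by
  obtain ⟨n, hn⟩ : ∃ n, n = max (max v.re.natDegree v.imI.natDegree)
    (max v.imJ.natDegree v.imK.natDegree) := ⟨_, rfl⟩
  by_cases hnm : n ≤ m
  · omega
  have hc := coeff_nrd v n (by omega) (by omega) (by omega) (by omega)
  rw [coeff_eq_zero_of_natDegree_lt (by omega)] at hc
  have hz := QuaternionAlgebra.ext_iff.mp (h _ hc.symm)
  simp only [QuaternionAlgebra.re_zero, QuaternionAlgebra.imI_zero, QuaternionAlgebra.imJ_zero,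
    QuaternionAlgebra.imK_zero] at hz
  obtain ⟨z0, z1, z2, z3⟩ := hz
  have aux : ∀ p : k[X], n = p.natDegree → p.coeff n = 0 → False := by
    rintro p rfl hp
    have : p = 0 := leadingCoeff_eq_zero.mp hp
    simp [this] at hnm
  rcases (by omega : n = v.re.natDegree ∨ n = v.imI.natDegree ∨ n = v.imJ.natDegree ∨
    n = v.imK.natDegree) with e | e | e | e
  · exact (aux _ e z0).elim
  · exact (aux _ e z1).elim
  · exact (aux _ e z2).elim
  · exact (aux _ e z3).elim

theorem Aniso.polynomial (h : Aniso a b) : Aniso (C a) (C b) := by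
  intro v hv
  obtain ⟨h0, h1, h2, h3⟩ := h.natDegree_le v 0 (by simp [hv])
  have hc := coeff_nrd v 0 h0 h1 h2 h3
  rw [hv, coeff_zero] at hc
  have hz := QuaternionAlgebra.ext_iff.mp (h _ hc.symm)
  simp only [QuaternionAlgebra.re_zero, QuaternionAlgebra.imI_zero, QuaternionAlgebra.imJ_zero,
    QuaternionAlgebra.imK_zero] at hz
  obtain ⟨z0, z1, z2, z3⟩ := hz
  ext1
  · rw [eq_C_of_natDegree_le_zero h0, z0]; simp
  · rw [eq_C_of_natDegree_le_zero h1, z1]; simp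
  · rw [eq_C_of_natDegree_le_zero h2, z2]; simp
  · rw [eq_C_of_natDegree_le_zero h3, z3]; simp

/-- Right ideals of the ring of polynomials over a quaternion division algebra are principal. -/
theorem Aniso.exists_generator (h : Aniso a b) (J : AddSubgroup ℍ[k[X], C a, 0, C b])
    (hJ : ∀ u ∈ J, ∀ w, u * w ∈ J) (h0 : ∃ u ∈ J, u ≠ 0) :
    ∃ g ∈ J, g ≠ 0 ∧ ∀ u ∈ J, ∃ q, u = g * q := by
  -- Euclidean division, with the degree of the reduced norm as size.
  obtain ⟨g, ⟨hgJ, hg0⟩, hmin⟩ := (measure fun u : ℍ[k[X], C a, 0, C b] =>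
    (nrd u).natDegree).wf.has_min {u | u ∈ J ∧ u ≠ 0} h0
  refine ⟨g, hgJ, hg0, fun u hu => ?_⟩
  have hn0 : nrd g ≠ 0 := fun hn => hg0 (h.polynomial g hn)
  obtain ⟨w, hw⟩ : ∃ w, w = star g * u := ⟨_, rfl⟩
  -- To divide `u` by `g`, divide `star g * u` by the central polynomial `nrd g` in each coordinate.
  -- The remainder `s` is `star g` times `u - g * q`, so comparing norms bounds the size of the
  -- latter.
  let q : ℍ[k[X], C a, 0, C b] := ⟨w.re / nrd g, w.imI / nrd g, w.imJ / nrd g, w.imK / nrd g⟩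
  let s : ℍ[k[X], C a, 0, C b] := ⟨w.re % nrd g, w.imI % nrd g, w.imJ % nrd g, w.imK % nrd g⟩
  have hwqs : w = algebraMap _ _ (nrd g) * q + s := by
    ext1 <;> simp [QuaternionAlgebra.algebraMap_eq, q, s, EuclideanDomain.div_add_mod]
  have hrJ : u - g * q ∈ J := J.sub_mem hu (hJ g hgJ q)
  have hs : star g * (u - g * q) = s := by
    rw [mul_sub, ← hw, ← mul_assoc, star_mul_eq_nrd, hwqs, add_sub_cancel_left]
  refine ⟨q, sub_eq_zero.mp ?_⟩
  by_contra hr0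
  have hrn : nrd (u - g * q) ≠ 0 := fun hn => hr0 (h.polynomial _ hn)
  have hle : (nrd g).natDegree ≤ (nrd (u - g * q)).natDegree :=
    not_lt.mp (hmin _ ⟨hrJ, hr0⟩)
  have hns : nrd g * nrd (u - g * q) = nrd s := by rw [← hs, nrd_mul, nrd_star]
  have hdeg := natDegree_mul hn0 hrn
  rw [hns] at hdeg
  by_cases hN : (nrd g).natDegree = 0
  · have hu : IsUnit (nrd g) := isUnit_iff_degree_eq_zero.mpr (by
      rw [degree_eq_natDegree hn0, hN]; rfl)
    have hz : ∀ p : k[X], p % nrd g = 0 := fun p => EuclideanDomain.mod_eq_zero.mpr hu.dvd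
    have hs0 : s = 0 := by ext1 <;> exact hz _
    rw [hs0, nrd_zero] at hns
    exact mul_ne_zero hn0 hrn hns
  -- With N the degree of `nrd g`, the norm of `s` has degree at most 2(N - 1), but N plus the
  -- degree of `nrd (u - g * q)` is at least 2N by minimality.
  · have hz : ∀ p : k[X], (p % nrd g).natDegree ≤ (nrd g).natDegree - 1 := fun p =>
      Nat.le_sub_one_of_lt (natDegree_mod_lt p hN)
    have := natDegree_nrd_le s _ (hz _) (hz _) (hz _) (hz _)
    omega

/-- Pairwise anticommuting elements with integral squares stabilize a nonzero right ideal. -/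
theorem exists_stable_ideal {A M ι : Type*} [CommRing A] [IsDomain A] [Field M] [Algebra A M]
    [IsFractionRing A M] {a b : A} {a' b' : M} (ha : algebraMap A M a = a')
    (hb : algebraMap A M b = b') (h : Aniso a b) (s : Finset ι) (β : ι → ℍ[M, a', 0, b'])
    (hsq : ∀ i ∈ s, ∃ c : A, β i * β i = algebraMap M _ (algebraMap A M c))
    (hanti : ∀ i ∈ s, ∀ j ∈ s, i ≠ j → β i * β j = -(β j * β i)) :
    ∃ J : AddSubgroup ℍ[A, a, 0, b], (∀ u ∈ J, ∀ w, u * w ∈ J) ∧ (∃ u ∈ J, u ≠ 0) ∧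
      ∀ i ∈ s, ∀ u ∈ J, ∃ u' ∈ J,
        β i * qmap (algebraMap A M) ha hb u = qmap (algebraMap A M) ha hb u' := by
  classical
  induction s using Finset.induction_on with
  | empty => exact ⟨⊤, by simp, ⟨1, by simp, fun h1 => by
      simpa using congrArg QuaternionAlgebra.re h1⟩, by simp⟩
  | insert i s hi ih =>
    obtain ⟨J, hJ, ⟨u, hu, hu0⟩, hst⟩ := ih (fun j hj => hsq j (Finset.mem_insert_of_mem hj))
      fun j hj l hl => hanti j (Finset.mem_insert_of_mem hj) l (Finset.mem_insert_of_mem hl)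
    -- Shrink `J` to the elements that `β i` keeps in `J`.
    let J' : AddSubgroup ℍ[A, a, 0, b] :=
      { carrier := {u | u ∈ J ∧ ∃ u' ∈ J,
          β i * qmap (algebraMap A M) ha hb u = qmap (algebraMap A M) ha hb u'}
        zero_mem' := ⟨J.zero_mem, 0, J.zero_mem, by simp⟩
        add_mem' := by
          rintro x y ⟨hx, x', hx', ex⟩ ⟨hy, y', hy', ey⟩
          exact ⟨J.add_mem hx hy, x' + y', J.add_mem hx' hy', by
            rw [map_add, mul_add, ex, ey, map_add]⟩
        neg_mem' := by
          rintro x ⟨hx, x', hx', ex⟩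
          exact ⟨J.neg_mem hx, -x', J.neg_mem hx', by rw [map_neg, mul_neg, ex, map_neg]⟩ }
    refine ⟨J', ?_, ?_, ?_⟩
    · rintro x ⟨hx, x', hx', ex⟩ w
      exact ⟨hJ x hx w, x' * w, hJ x' hx' w, by rw [map_mul, ← mul_assoc, ex, map_mul]⟩
    · obtain ⟨d, hd, p, hp⟩ := exists_qmap_eq_mul ha hb (β i)
      have hn0 : nrd u ≠ 0 := fun hn => hu0 (h u hn)
      have hnJ : algebraMap A ℍ[A, a, 0, b] (nrd u) ∈ J := by
        rw [← mul_star_eq_nrd]; exact hJ u hu _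
      -- The scalar `nrd u` lies in `J` and `d` clears the denominators of `β i`, so their product
      -- is a nonzero element of `J'`.
      refine ⟨algebraMap A _ (nrd u) * algebraMap A _ d, ⟨hJ _ hnJ _,
        algebraMap A _ (nrd u) * p, hJ _ hnJ _, ?_⟩, ?_⟩
      · rw [map_mul, map_mul, hp, qmap_algebraMap, qmap_algebraMap, ← mul_assoc, ← mul_assoc,
          Algebra.commutes (algebraMap A M (nrd u)) (β i)]
      · rw [← map_mul]
        intro h0
        have := congrArg QuaternionAlgebra.re h0
        simp [QuaternionAlgebra.algebraMap_eq, hn0, hd] at this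
    · obtain ⟨c, hc⟩ := hsq i (Finset.mem_insert_self _ _)
      intro j hj x hx
      obtain ⟨hxJ, x', hx', ex⟩ := hx
      rcases Finset.mem_insert.mp hj with rfl | hjs
      -- `J'` is stable under `β i` because its square is an integral scalar, and under the other `β
      -- j` because they anticommute with `β i`.
      · refine ⟨x', ⟨hx', x * algebraMap A _ c, hJ x hxJ _, ?_⟩, ex⟩
        rw [← ex, ← mul_assoc, hc, map_mul, qmap_algebraMap, Algebra.commutes]
      · obtain ⟨y, hy, ey⟩ := hst j hjs x hxJ
        obtain ⟨z, hz, ez⟩ := hst j hjs x' hx'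
        have hij : i ≠ j := fun e => hi (e ▸ hjs)
        refine ⟨y, ⟨hy, -z, J.neg_mem hz, ?_⟩, ey⟩
        rw [← ey, ← mul_assoc, hanti i (Finset.mem_insert_self _ _) j hj hij, neg_mul, mul_assoc,
          ex, ez, map_neg]

/-- If `g` generates a right ideal stable under all `β i`, then `β i * g = g * γ i` with `γ i`
integral: the relations among the `β i` pass to these conjugates by cancelling `g`. -/
theorem Aniso.exists_conj {M ι : Type*} [Fintype ι] [Field M] [Algebra k[X] M]
    [IsFractionRing k[X] M] {a' b' : M} (ha : algebraMap k[X] M (C a) = a')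
    (hb : algebraMap k[X] M (C b) = b') (h : Aniso a b) (β : ι → ℍ[M, a', 0, b']) (c : ι → k[X])
    (hsq : ∀ i, β i * β i = algebraMap M _ (algebraMap k[X] M (c i)))
    (hanti : ∀ i j, i ≠ j → β i * β j = -(β j * β i)) :
    ∃ γ : ι → ℍ[k[X], C a, 0, C b], (∀ i, γ i * γ i = algebraMap _ _ (c i)) ∧
      ∀ i j, i ≠ j → γ i * γ j = -(γ j * γ i) := by
  obtain ⟨J, hJ, hJ0, hst⟩ := exists_stable_ideal ha hb h.polynomial Finset.univ β
    (fun i _ => ⟨c i, hsq i⟩) fun i _ j _ => hanti i j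
  obtain ⟨g, hg, hg0, hgen⟩ := h.exists_generator J hJ hJ0
  have hγ : ∀ i, ∃ γ, β i * qmap (algebraMap k[X] M) ha hb g =
      qmap (algebraMap k[X] M) ha hb (g * γ) := fun i => by
    obtain ⟨u, hu, e⟩ := hst i (Finset.mem_univ i) g hg
    obtain ⟨q, rfl⟩ := hgen u hu
    exact ⟨q, e⟩
  choose γ hγ using hγ
  have hinj := qmap_injective (algebraMap k[X] M) ha hb (IsFractionRing.injective _ _)
  have hmul : ∀ i j, qmap (algebraMap k[X] M) ha hb (g * (γ i * γ j)) =
      β i * β j * qmap (algebraMap k[X] M) ha hb g := fun i j => by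
    rw [mul_assoc (β i), hγ j, map_mul _ g (γ j), ← mul_assoc (β i), hγ i, ← map_mul, mul_assoc]
  refine ⟨γ, fun i => h.polynomial.mul_left_cancel hg0 (hinj ?_), fun i j hij =>
    h.polynomial.mul_left_cancel hg0 (hinj ?_)⟩
  · rw [hmul, hsq, ← Algebra.commutes (c i) g, map_mul, qmap_algebraMap]
  · rw [hmul, mul_neg, map_neg, hmul, hanti i j hij, neg_mul]

/-- The norm of `v` has square `c ^ 2`, so it is constant, and then the coordinates of `v` are
constant by anisotropy. The next lemma is the analogue in degree one. -/
theorem Aniso.eq_qmap_C (h : Aniso a b) {v : ℍ[k[X], C a, 0, C b]} {c : k}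
    (hv : v * v = algebraMap _ _ (C c)) : ∃ δ : ℍ[k, a, 0, b], v = qmap C rfl rfl δ := by
  have hn : nrd v ^ 2 = C c ^ 2 := by rw [sq, ← nrd_mul, hv, nrd_algebraMap]
  have hd : (nrd v).natDegree ≤ 2 * 0 := by
    have := congrArg natDegree hn
    simp only [natDegree_pow, natDegree_C] at this
    omega
  obtain ⟨h0, h1, h2, h3⟩ := h.natDegree_le v 0 hd
  refine ⟨⟨v.re.coeff 0, v.imI.coeff 0, v.imJ.coeff 0, v.imK.coeff 0⟩, ?_⟩
  ext1
  · exact eq_C_of_natDegree_le_zero h0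
  · exact eq_C_of_natDegree_le_zero h1
  · exact eq_C_of_natDegree_le_zero h2
  · exact eq_C_of_natDegree_le_zero h3

theorem Aniso.eq_qmap_C_add (h : Aniso a b) {v : ℍ[k[X], C a, 0, C b]} {f e : k}
    (hv : v * v = algebraMap _ _ (C f * X ^ 2 + C e)) : ∃ A B : ℍ[k, a, 0, b],
      v = qmap C rfl rfl A + qmap C rfl rfl B * algebraMap k[X] _ X := by
  have hn : nrd v ^ 2 = (C f * X ^ 2 + C e) ^ 2 := by rw [sq, ← nrd_mul, hv, nrd_algebraMap]
  have hd : (nrd v).natDegree ≤ 2 * 1 := by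
    have := congrArg natDegree hn
    simp only [natDegree_pow] at this
    have : (C f * X ^ 2 + C e).natDegree ≤ 2 := by compute_degree
    omega
  obtain ⟨h0, h1, h2, h3⟩ := h.natDegree_le v 1 hd
  refine ⟨⟨v.re.coeff 0, v.imI.coeff 0, v.imJ.coeff 0, v.imK.coeff 0⟩,
    ⟨v.re.coeff 1, v.imI.coeff 1, v.imJ.coeff 1, v.imK.coeff 1⟩, ?_⟩
  have key : ∀ p : k[X], p.natDegree ≤ 1 → p = C (p.coeff 0) + C (p.coeff 1) * X := fun p hp => by
    rw [add_comm]; exact eq_X_add_C_of_natDegree_le_one hp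
  ext1
  · simpa [QuaternionAlgebra.algebraMap_eq] using key _ h0
  · simpa [QuaternionAlgebra.algebraMap_eq] using key _ h1
  · simpa [QuaternionAlgebra.algebraMap_eq] using key _ h2
  · simpa [QuaternionAlgebra.algebraMap_eq] using key _ h3

theorem qmap_C_coeff_eq {A B D A' B' D' : ℍ[k, a, 0, b]}
    (h : qmap C rfl rfl A + qmap C rfl rfl B * algebraMap k[X] _ X +
        qmap C rfl rfl D * algebraMap k[X] _ (X ^ 2) =
      (qmap C rfl rfl A' + qmap C rfl rfl B' * algebraMap k[X] _ X +
        qmap C rfl rfl D' * algebraMap k[X] _ (X ^ 2) : ℍ[k[X], C a, 0, C b])) :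
    A = A' ∧ B = B' ∧ D = D' := by
  have key : ∀ x y z x' y' z' : k, C x + C y * X + C z * X ^ 2 = C x' + C y' * X + C z' * X ^ 2 →
      x = x' ∧ y = y' ∧ z = z' := fun x y z x' y' z' e =>
    ⟨by simpa using congrArg (coeff · 0) e, by simpa [coeff_X, coeff_C] using congrArg (coeff · 1) e,
      by simpa [coeff_X, coeff_C] using congrArg (coeff · 2) e⟩
  have h' := QuaternionAlgebra.ext_iff.mp h
  simp only [QuaternionAlgebra.algebraMap_eq, QuaternionAlgebra.re_add,
    QuaternionAlgebra.imI_add, QuaternionAlgebra.imJ_add, QuaternionAlgebra.imK_add,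
    QuaternionAlgebra.re_mul, QuaternionAlgebra.imI_mul, QuaternionAlgebra.imJ_mul,
    QuaternionAlgebra.imK_mul, qmap_re, qmap_imI, qmap_imJ, qmap_imK, mul_zero, zero_mul, add_zero,
    sub_zero, zero_add] at h'
  obtain ⟨h0, h1, h2, h3⟩ := h'
  have k0 := key _ _ _ _ _ _ h0
  have k1 := key _ _ _ _ _ _ h1
  have k2 := key _ _ _ _ _ _ h2
  have k3 := key _ _ _ _ _ _ h3
  exact ⟨QuaternionAlgebra.ext k0.1 k1.1 k2.1 k3.1,
    QuaternionAlgebra.ext k0.2.1 k1.2.1 k2.2.1 k3.2.1,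
    QuaternionAlgebra.ext k0.2.2 k1.2.2 k2.2.2 k3.2.2⟩

end Descent

/-! ### Anticommuting families and generic values of quadratic forms. -/

section Family

open Polynomial

/-- There are pairwise anticommuting elements `β, γ₁, …, γₘ` of `(a, b / M)` such that `β ^ 2 = s`
and the `γᵢ ^ 2` are nonzero elements of `K`. -/
def HasFamily (K : Type*) {M : Type*} [Field K] [Field M] [Algebra K M] (a b : M) (m : ℕ) (s : M) :
    Prop :=
  ∃ (β : ℍ[M, a, 0, b]) (γ : Fin m → ℍ[M, a, 0, b]), β * β = algebraMap M _ s ∧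
    (∀ i, ∃ c : K, c ≠ 0 ∧ γ i * γ i = algebraMap M _ (algebraMap K M c)) ∧
    (∀ i, γ i * β = -(β * γ i)) ∧ ∀ i j, i ≠ j → γ i * γ j = -(γ j * γ i)

theorem linear_mul_self {R : Type*} [Ring R] {A B x : R} (hA : x * A = A * x) (hB : x * B = B * x) :
    (A + B * x) * (A + B * x) = A * A + (A * B + B * A) * x + B * B * x ^ 2 := by
  have e1 : B * x * A = B * A * x := by rw [mul_assoc, hA, mul_assoc]
  have e2 : B * x * (B * x) = B * B * x ^ 2 := by
    rw [mul_assoc B x, ← mul_assoc x B, hB, sq]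
    simp only [mul_assoc]
  rw [mul_add, add_mul, add_mul, e1, e2, add_mul, mul_assoc A B]
  abel

theorem coeff_of_sq {k : Type*} [Field k] {a b f e : k} {A B : ℍ[k, a, 0, b]}
    (h : (qmap C rfl rfl A + qmap C rfl rfl B * algebraMap k[X] ℍ[k[X], C a, 0, C b] X) *
      (qmap C rfl rfl A + qmap C rfl rfl B * algebraMap k[X] _ X) =
        algebraMap k[X] _ (C f * X ^ 2 + C e)) :
    A * A = algebraMap _ _ e ∧ A * B + B * A = 0 ∧ B * B = algebraMap _ _ f := by
  apply qmap_C_coeff_eq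
  rw [linear_mul_self (Algebra.commutes _ _) (Algebra.commutes _ _)] at h
  rw [map_mul, map_mul, map_add, map_mul, map_mul, map_pow, h, map_zero, zero_mul, add_zero,
    qmap_algebraMap, qmap_algebraMap, map_add, map_mul, map_pow, add_comm]

theorem coeff_of_anticomm {k : Type*} [Field k] {a b : k} {A B D : ℍ[k, a, 0, b]}
    (h : qmap C rfl rfl D *
        (qmap C rfl rfl A + qmap C rfl rfl B * algebraMap k[X] ℍ[k[X], C a, 0, C b] X) =
      -((qmap C rfl rfl A + qmap C rfl rfl B * algebraMap k[X] _ X) * qmap C rfl rfl D)) :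
    D * A = -(A * D) ∧ D * B = -(B * D) := by
  have h2 : D * A = -(A * D) ∧ D * B = -(B * D) ∧ (0 : ℍ[k, a, 0, b]) = 0 := by
    apply qmap_C_coeff_eq
    rw [mul_add, add_mul, mul_assoc (qmap C rfl rfl B), Algebra.commutes, ← mul_assoc, ← mul_assoc,
      neg_add] at h
    rw [map_neg, map_neg, map_mul, map_mul, map_mul, map_mul, map_zero, zero_mul, add_zero,
      add_zero, h, neg_mul]
  exact ⟨h2.1, h2.2.1⟩

/-- After a simultaneous conjugation `β` becomes `A + B * X` and the `γ i` become constants. Then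
`A` is the new `β`, while `B`, of square `f`, joins the family. -/
theorem HasFamily.descend {K k : Type*} [Field K] [Field k] [Algebra K k] {a b : k}
    (h : Aniso a b) {m : ℕ} {f : K} (hf : f ≠ 0) {e : k}
    (H : HasFamily K (algebraMap k (RatFunc k) a) (algebraMap k (RatFunc k) b) m
      (algebraMap K (RatFunc k) f * RatFunc.X ^ 2 + algebraMap k (RatFunc k) e)) :
    HasFamily K a b (m + 1) e := by
  obtain ⟨β, γ, hβ, hγ, hγβ, hγγ⟩ := H
  choose c hc0 hc using hγ
  have hkX : ∀ x : k, algebraMap k[X] (RatFunc k) (C x) = algebraMap k (RatFunc k) x := fun x => by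
    simp
  have hKk : ∀ x : K, algebraMap k (RatFunc k) (algebraMap K k x) = algebraMap K (RatFunc k) x :=
    fun x => (IsScalarTower.algebraMap_apply K k (RatFunc k) x).symm
  -- All elements must be conjugated by the same `g`; the index `none` stands for `β`.
  obtain ⟨δ, hδ, hδδ⟩ := h.exists_conj (hkX a) (hkX b) (fun o : Option (Fin m) => o.elim β γ)
    (fun o => o.elim (C (algebraMap K k f) * X ^ 2 + C e) fun i => C (algebraMap K k (c i))) (by
      rintro (_ | i)
      · simp only [Option.elim_none, hβ, map_add, map_mul, map_pow, hkX, hKk, RatFunc.algebraMap_X]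
      · simp only [Option.elim_some, hc, hkX, hKk]) (by
      rintro (_ | i) (_ | j) hij
      · exact (hij rfl).elim
      · exact (neg_eq_iff_eq_neg.mpr (hγβ j)).symm
      · exact hγβ i
      · exact hγγ i j fun e => hij (congrArg some e))
  have hs : ∀ i, ∃ ε : ℍ[k, a, 0, b], δ (some i) = qmap C rfl rfl ε := fun i => h.eq_qmap_C (hδ _)
  choose ε hε using hs
  obtain ⟨A, B, hAB⟩ := h.eq_qmap_C_add (hδ none)
  have hinj : Function.Injective (qmap C rfl rfl : ℍ[k, a, 0, b] →+* ℍ[k[X], C a, 0, C b]) :=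
    qmap_injective _ _ _ C_injective
  have h0 := coeff_of_sq (hAB ▸ hδ none)
  have h1 : ∀ i, ε i * A = -(A * ε i) ∧ ε i * B = -(B * ε i) := fun i =>
    coeff_of_anticomm (hAB ▸ hε i ▸ hδδ (some i) none (by simp))
  refine ⟨A, Fin.cons B ε, h0.1, ?_, ?_, ?_⟩
  · refine Fin.cases ⟨f, hf, h0.2.2⟩ fun i => ⟨c i, hc0 i, ?_⟩
    rw [Fin.cons_succ]
    apply hinj
    rw [map_mul, ← hε, hδ, qmap_algebraMap]
    rfl
  · refine Fin.cases ?_ fun i => ?_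
    · rw [Fin.cons_zero]
      exact eq_neg_of_add_eq_zero_right h0.2.1
    · rw [Fin.cons_succ]
      exact (h1 i).1
  · refine Fin.cases (Fin.cases (by simp) fun j _ => ?_) fun i => Fin.cases (fun _ => ?_) fun j hij => ?_
    · rw [Fin.cons_zero, Fin.cons_succ, (h1 j).2, neg_neg]
    · rw [Fin.cons_zero, Fin.cons_succ, (h1 i).2]
    · rw [Fin.cons_succ, Fin.cons_succ]
      apply hinj
      rw [map_neg, map_mul, map_mul, ← hε, ← hε]
      exact hδδ _ _ (by simpa using fun e => hij (congrArg Fin.succ e))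

theorem algebraicIndependent_cons_X {K M : Type*} [Field K] [Field M] [Algebra K M] {n : ℕ}
    {t : Fin n → M} (ht : AlgebraicIndependent K t) :
    AlgebraicIndependent K
      (Fin.cons RatFunc.X (algebraMap M (RatFunc M) ∘ t) : Fin (n + 1) → RatFunc M) := by
  have hX : AlgebraicIndependent M fun _ : Unit => (RatFunc.X : RatFunc M) := by
    rw [algebraicIndependent_unique_type_iff]
    exact RatFunc.transcendental_X
  have h := (ht.sumElim_comp hX).comp (Fin.cons (Sum.inl ()) Sum.inr : Fin (n + 1) → Unit ⊕ Fin n)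
    (Fin.cons_injective_iff.mpr ⟨by simp, Sum.inr_injective⟩)
  convert h using 1
  funext i
  refine Fin.cases ?_ (fun i => ?_) i <;> simp

theorem Aniso.ratFunc {k : Type*} [Field k] {a b : k} (h : Aniso a b) :
    Aniso (algebraMap k (RatFunc k) a) (algebraMap k (RatFunc k) b) :=
  h.polynomial.fractionRing (by simp) (by simp)

/-- `M` is an iterated rational function field. Each variable, removed by `HasFamily.descend`,
contributes one member to the family; the squares `d i` must lie in `K` for the count to accumulate.
-/
theorem exists_generic {K : Type u} [Field K] {a b : K} (h : Aniso a b) (n : ℕ) (d : Fin n → K)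
    (hd : ∀ i, d i ≠ 0) : ∃ (M : Type u) (_ : Field M) (_ : Algebra K M) (t : Fin n → M),
      AlgebraicIndependent K t ∧ Aniso (algebraMap K M a) (algebraMap K M b) ∧
      ∀ (m : ℕ) (e : K), HasFamily K (algebraMap K M a) (algebraMap K M b) m
        (∑ i, algebraMap K M (d i) * t i ^ 2 + algebraMap K M e) → HasFamily K a b (m + n) e := by
  induction n with
  | zero =>
    exact ⟨K, inferInstance, inferInstance, Fin.elim0, algebraicIndependent_empty_type, h,
      fun m e H => by simpa using H⟩
  | succ n ih =>
    obtain ⟨M, _, _, t, ht, hM, hdesc⟩ := ih (Fin.tail d) fun i => hd _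
    have htow : ∀ x : K, algebraMap M (RatFunc M) (algebraMap K M x) = algebraMap K (RatFunc M) x :=
      fun x => (IsScalarTower.algebraMap_apply K M (RatFunc M) x).symm
    refine ⟨RatFunc M, inferInstance, inferInstance, _, algebraicIndependent_cons_X ht, ?_,
      fun m e H => ?_⟩
    · rw [← htow, ← htow]
      exact hM.ratFunc
    · have := hdesc (m + 1) e
      rw [show m + (n + 1) = m + 1 + n by omega]
      apply this
      apply HasFamily.descend hM (hd 0)
      rw [htow, htow]
      convert H using 1
      rw [Fin.sum_univ_succ, map_add, map_sum]
      simp only [map_mul, map_pow, htow, Fin.tail, Fin.cons_zero, Fin.cons_succ, add_assoc,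
        Function.comp_apply]

/-- Two quaternions commute exactly when their pure parts are proportional, so the centralizer of a
nonscalar quaternion is commutative. -/
theorem commute_of_commute {K : Type*} [Field K] (h2 : (2 : K) ≠ 0) {a b : K} (ha : a ≠ 0)
    (hb : b ≠ 0) {u v w : ℍ[K, a, 0, b]} (hw : w.imI ≠ 0 ∨ w.imJ ≠ 0 ∨ w.imK ≠ 0)
    (hu : u * w = w * u) (hv : v * w = w * v) : u * v = v * u := by
  have key : ∀ x y : ℍ[K, a, 0, b], x * y = y * x ↔ x.imI * y.imJ = x.imJ * y.imI ∧
      x.imI * y.imK = x.imK * y.imI ∧ x.imJ * y.imK = x.imK * y.imJ := fun x y => by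
    rw [QuaternionAlgebra.ext_iff]
    simp only [QuaternionAlgebra.re_mul, QuaternionAlgebra.imI_mul, QuaternionAlgebra.imJ_mul,
      QuaternionAlgebra.imK_mul]
    constructor
    · rintro ⟨-, h1, h2', h3⟩
      refine ⟨mul_left_cancel₀ h2 ?_, mul_left_cancel₀ (mul_ne_zero h2 ha) ?_,
        mul_left_cancel₀ (mul_ne_zero h2 hb) ?_⟩
      · linear_combination h3
      · linear_combination h2'
      · linear_combination -h1
    · rintro ⟨h1, h2', h3⟩
      exact ⟨by ring, by linear_combination -2 * b * h3, by linear_combination 2 * a * h2',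
        by linear_combination 2 * h1⟩
  rw [key] at *
  obtain ⟨u1, u2, u3⟩ := hu
  obtain ⟨v1, v2, v3⟩ := hv
  rcases hw with hw | hw | hw
  · refine ⟨mul_left_cancel₀ hw ?_, mul_left_cancel₀ hw ?_, mul_left_cancel₀ hw ?_⟩ <;> grind
  · refine ⟨mul_left_cancel₀ hw ?_, mul_left_cancel₀ hw ?_, mul_left_cancel₀ hw ?_⟩ <;> grind
  · refine ⟨mul_left_cancel₀ hw ?_, mul_left_cancel₀ hw ?_, mul_left_cancel₀ hw ?_⟩ <;> grind

theorem eq_algebraMap_of_im_eq_zero {R : Type*} [CommRing R] {a b : R} {w : ℍ[R, a, 0, b]}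
    (hw : ¬ (w.imI ≠ 0 ∨ w.imJ ≠ 0 ∨ w.imK ≠ 0)) : w = algebraMap R _ w.re := by
  push Not at hw
  ext <;> simp [QuaternionAlgebra.algebraMap_eq, hw]

/-- Given four such elements, the product of the first two is not scalar and commutes with the other
two. These then commute as well as anticommute, so their product vanishes. -/
theorem Aniso.not_hasFamily {K : Type*} [Field K] (h2 : (2 : K) ≠ 0) {a b : K} (ha : a ≠ 0)
    (hb : b ≠ 0) (h : Aniso a b) {m : ℕ} (hm : 4 ≤ m) (s : K) : ¬ HasFamily K a b m s := by
  rintro ⟨-, γ, -, hsq, -, hanti⟩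
  have hγ0 : ∀ i, γ i ≠ 0 := fun i e => by
    obtain ⟨c, hc0, hc⟩ := hsq i
    rw [e, mul_zero, eq_comm, map_eq_zero_iff _ QuaternionAlgebra.algebraMap_injective] at hc
    exact hc0 hc
  have h2' : ∀ x : ℍ[K, a, 0, b], x = -x → x = 0 := fun x hx => by
    have : (2 : K) • x = 0 := by rw [two_smul]; exact add_eq_zero_iff_eq_neg.mpr hx
    exact (smul_eq_zero.mp this).resolve_left h2
  let i0 : Fin m := ⟨0, by omega⟩
  let i1 : Fin m := ⟨1, by omega⟩
  let i2 : Fin m := ⟨2, by omega⟩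
  let i3 : Fin m := ⟨3, by omega⟩
  have h01 := hanti i0 i1 (by simp [i0, i1])
  have hcomm : ∀ j, j ≠ i0 → j ≠ i1 → γ j * (γ i0 * γ i1) = γ i0 * γ i1 * γ j := fun j h0 h1 => by
    rw [← mul_assoc, hanti j i0 h0, neg_mul, mul_assoc, hanti j i1 h1, mul_neg, neg_neg, mul_assoc]
  have hw : (γ i0 * γ i1).imI ≠ 0 ∨ (γ i0 * γ i1).imJ ≠ 0 ∨ (γ i0 * γ i1).imK ≠ 0 := by
    by_contra hw
    have hc : γ i0 * (γ i0 * γ i1) = γ i0 * γ i1 * γ i0 := by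
      rw [eq_algebraMap_of_im_eq_zero hw, Algebra.commutes]
    have := h2' (γ i0 * (γ i0 * γ i1)) (by
      nth_rewrite 1 [hc]
      rw [mul_assoc, hanti i1 i0 (by simp [i0, i1]), mul_neg])
    rcases h.mul_eq_zero this with h0 | h0
    · exact hγ0 _ h0
    · rcases h.mul_eq_zero h0 with h0 | h0 <;> exact hγ0 _ h0
  have hc := commute_of_commute h2 ha hb hw (hcomm i2 (by simp [i0, i2]) (by simp [i1, i2]))
    (hcomm i3 (by simp [i0, i3]) (by simp [i1, i3]))
  have := h2' (γ i2 * γ i3) (by nth_rewrite 1 [hc]; exact hanti i3 i2 (by simp [i2, i3]))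
  rcases h.mul_eq_zero this with h0 | h0 <;> exact hγ0 _ h0

/-- Over a rational function field, a quaternion algebra that remains division contains no square
root of a generic value of a quadratic form of dimension at least four. -/
theorem exists_generic_ne {K : Type u} [Field K] (h2 : (2 : K) ≠ 0) {a b : K} (ha : a ≠ 0)
    (hb : b ≠ 0) (h : Aniso a b) {n : ℕ} (hn : 4 ≤ n) (d : Fin n → K) (hd : ∀ i, d i ≠ 0) :
    ∃ (M : Type u) (_ : Field M) (_ : Algebra K M) (t : Fin n → M), AlgebraicIndependent K t ∧
      Aniso (algebraMap K M a) (algebraMap K M b) ∧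
      ∀ β : ℍ[M, algebraMap K M a, 0, algebraMap K M b],
        β * β ≠ algebraMap M _ (∑ i, algebraMap K M (d i) * t i ^ 2) := by
  obtain ⟨M, _, _, t, ht, hM, hdesc⟩ := exists_generic h n d hd
  refine ⟨M, inferInstance, inferInstance, t, ht, hM, fun β hβ => ?_⟩
  -- A square root of the generic value is a family with no `γ` yet and constant term 0.
  refine h.not_hasFamily h2 ha hb (m := 0 + n) (by omega) 0 (hdesc 0 0 ⟨β, Fin.elim0, ?_⟩)
  simp [hβ]

end Family

/-! ### The function field of a diagonal form. -/

section FunctionField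

open MvPolynomial IntermediateField

variable {K : Type u} [Field K]

/-- The diagonal quadratic form with the given coefficients, as a polynomial. -/
noncomputable def diagPoly {n : ℕ} (c : Fin n → K) : MvPolynomial (Fin n) K :=
  ∑ i, C (c i) * X i ^ 2

theorem aeval_diagPoly {L : Type*} [CommRing L] [Algebra K L] {n : ℕ} (c : Fin n → K)
    (t : Fin n → L) : aeval t (diagPoly c) = ∑ i, algebraMap K L (c i) * t i ^ 2 := by
  simp [diagPoly]

theorem exists_linear_repr {n : ℕ} {c₀ : K} (hc : c₀ ≠ 0) (d : Fin n → K)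
    (p : MvPolynomial (Fin (n + 1)) K) : ∃ p₀ p₁ : MvPolynomial (Fin n) K,
      p - (rename Fin.succ p₀ + rename Fin.succ p₁ * X 0) ∈
        Ideal.span {C c₀ * (X 0 ^ 2 - rename Fin.succ (diagPoly d))} := by
  have hP : X 0 ^ 2 - rename Fin.succ (diagPoly d) ∈
      Ideal.span {C c₀ * (X 0 ^ 2 - rename Fin.succ (diagPoly d))} :=
    Ideal.mem_span_singleton.mpr ⟨C c₀⁻¹, by
      rw [mul_right_comm, ← C_mul, mul_inv_cancel₀ hc, C_1, one_mul]⟩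
  induction p using MvPolynomial.induction_on with
  | C x => exact ⟨C x, 0, by simp⟩
  | add p q hp hq =>
    obtain ⟨p₀, p₁, hp⟩ := hp
    obtain ⟨q₀, q₁, hq⟩ := hq
    refine ⟨p₀ + q₀, p₁ + q₁, ?_⟩
    convert Ideal.add_mem _ hp hq using 1
    simp only [map_add]
    ring
  | mul_X p i hp =>
    obtain ⟨p₀, p₁, hp⟩ := hp
    refine Fin.cases ?_ (fun i => ?_) i
    · refine ⟨p₁ * diagPoly d, p₀, ?_⟩
      convert Ideal.add_mem _ (Ideal.mul_mem_right (X 0) _ hp)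
        (Ideal.mul_mem_left _ (rename Fin.succ p₁) hP) using 1
      simp only [map_mul]
      ring
    · refine ⟨p₀ * X i, p₁ * X i, ?_⟩
      convert Ideal.mul_mem_right (X i.succ) _ hp using 1
      simp only [map_mul, rename_X]
      ring

variable {L : Type*} [Field L] [Algebra K L]

/-- If `q ≠ 0`, the quotient of `p` by `q` would be a scalar square root of the generic value,
against `exists_generic_ne`. The division algebra is only an auxiliary witness that the form is not
a square. -/
theorem Aniso.eq_zero_of_sq (h2 : (2 : K) ≠ 0) {a b : K} (ha : a ≠ 0) (hb : b ≠ 0)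
    (h : Aniso a b) {n : ℕ} (hn : 4 ≤ n) (d : Fin n → K) (hd : ∀ i, d i ≠ 0)
    {p q : MvPolynomial (Fin n) K} (hpq : p ^ 2 = diagPoly d * q ^ 2) : q = 0 := by
  obtain ⟨M, _, _, t, ht, -, hne⟩ := exists_generic_ne h2 ha hb h hn d hd
  by_contra hq
  have hq' : aeval t q ≠ 0 := by
    rwa [Ne, map_eq_zero_iff _ ht]
  apply hne (algebraMap M _ (aeval t p / aeval t q))
  rw [← map_mul, ← aeval_diagPoly, ← sq, div_pow, ← map_pow, hpq, map_mul, map_pow,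
    mul_div_assoc, div_self (pow_ne_zero 2 hq'), mul_one]

theorem Aniso.eq_zero_of_linear (h2 : (2 : K) ≠ 0) {a b : K} (ha : a ≠ 0) (hb : b ≠ 0)
    (h : Aniso a b) {n : ℕ} (hn : 4 ≤ n) (d : Fin n → K) (hd : ∀ i, d i ≠ 0) {t : Fin n → L}
    (ht : AlgebraicIndependent K t) {y : L} (hy : y ^ 2 = ∑ i, algebraMap K L (d i) * t i ^ 2)
    {p q : MvPolynomial (Fin n) K} (hpq : aeval t p + aeval t q * y = 0) : p = 0 ∧ q = 0 := by
  have hq : q = 0 := by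
    apply h.eq_zero_of_sq h2 ha hb hn d hd (p := p)
    apply ht
    rw [map_mul, map_pow, map_pow, aeval_diagPoly, ← hy, eq_neg_of_add_eq_zero_left hpq]
    ring
  refine ⟨?_, hq⟩
  rw [hq, map_zero, zero_mul, add_zero] at hpq
  exact (map_eq_zero_iff _ ht).mp hpq

theorem aeval_cons_rename {n : ℕ} (y : L) (t : Fin n → L) (p : MvPolynomial (Fin n) K) :
    aeval (Fin.cons y t : Fin (n + 1) → L) (rename Fin.succ p) = aeval t p := by
  rw [aeval_rename]
  rfl

/-- Modulo the quadric every polynomial is linear in `X 0`, and `1`, `y` are independent over the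
polynomials in `t`. -/
theorem Aniso.ker_aeval_cons (h2 : (2 : K) ≠ 0) {a b : K} (ha : a ≠ 0) (hb : b ≠ 0)
    (h : Aniso a b) {n : ℕ} (hn : 4 ≤ n) {c₀ : K} (hc : c₀ ≠ 0) (d : Fin n → K)
    (hd : ∀ i, d i ≠ 0) {t : Fin n → L} (ht : AlgebraicIndependent K t) {y : L}
    (hy : y ^ 2 = ∑ i, algebraMap K L (d i) * t i ^ 2) :
    RingHom.ker (aeval (R := K) (Fin.cons y t : Fin (n + 1) → L)) =
      Ideal.span {C c₀ * (X 0 ^ 2 - rename Fin.succ (diagPoly d))} := by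
  have hle : Ideal.span {C c₀ * (X 0 ^ 2 - rename Fin.succ (diagPoly d))} ≤
      RingHom.ker (aeval (R := K) (Fin.cons y t : Fin (n + 1) → L)) := by
    rw [Ideal.span_singleton_le_iff_mem, RingHom.mem_ker, map_mul, map_sub, aeval_cons_rename,
      aeval_diagPoly, map_pow, aeval_X, Fin.cons_zero, hy, sub_self, mul_zero]
  refine le_antisymm (fun p hp => ?_) hle
  obtain ⟨p₀, p₁, hr⟩ := exists_linear_repr hc d p
  have h0 := hle hr
  rw [RingHom.mem_ker] at h0 hp
  rw [map_sub, hp, map_add, map_mul, aeval_cons_rename, aeval_cons_rename, aeval_X, Fin.cons_zero,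
    zero_sub, neg_eq_zero] at h0
  obtain ⟨e0, e1⟩ := h.eq_zero_of_linear h2 ha hb hn d hd ht hy h0
  simpa [e0, e1] using hr

theorem exists_eq_linear {n : ℕ} (d : Fin n → K) {t : Fin n → L} {y : L}
    (hy : y ^ 2 = ∑ i, algebraMap K L (d i) * t i ^ 2) {z : L}
    (hz : z ∈ Algebra.adjoin K (Set.range (Fin.cons y t : Fin (n + 1) → L))) :
    ∃ p q : MvPolynomial (Fin n) K, z = aeval t p + aeval t q * y := by
  rw [Algebra.adjoin_range_eq_range_aeval] at hz
  obtain ⟨p, rfl⟩ := hz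
  obtain ⟨p₀, p₁, hr⟩ := exists_linear_repr one_ne_zero d p
  refine ⟨p₀, p₁, ?_⟩
  obtain ⟨r, hr⟩ := Ideal.mem_span_singleton.mp hr
  have := congrArg (aeval (Fin.cons y t : Fin (n + 1) → L)) hr
  simp only [map_sub, map_add, map_mul, aeval_cons_rename, aeval_diagPoly, aeval_X, map_pow,
    Fin.cons_zero, hy, sub_self, zero_mul, mul_zero] at this
  exact sub_eq_zero.mp this

/-- A quaternion algebra that is division over `M` remains so over a quadratic extension by the
square root of `s`, unless it contains a square root of `s`. -/
theorem Aniso.eq_zero_of_quadratic {M : Type*} [Field M] (h2 : (2 : M) ≠ 0) {a b s : M}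
    (h : Aniso a b) (hs : ∀ β : ℍ[M, a, 0, b], β * β ≠ algebraMap M _ s) {u v : ℍ[M, a, 0, b]}
    (h0 : nrd u + s * nrd v = 0) (h1 : 2 * (u * star v).re = 0) : u = 0 ∧ v = 0 := by
  have hv : v = 0 := by
    by_contra hv
    have hn : nrd v ≠ 0 := fun e => hv (h v e)
    -- The hypotheses say that `u + v√s` has norm zero; then `u * v⁻¹` is pure, of norm `-s`.
    apply hs (u * star v * algebraMap M _ (nrd v)⁻¹)
    have hre : (u * star v * algebraMap M _ (nrd v)⁻¹).re = 0 := by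
      have : (u * star v).re = 0 := (_root_.mul_eq_zero.mp h1).resolve_left h2
      rw [← Algebra.commutes, ← Algebra.smul_def, QuaternionAlgebra.re_smul, this, smul_zero]
    rw [mul_self_of_re_eq_zero hre, nrd_mul, nrd_mul, nrd_star, nrd_algebraMap,
      eq_neg_of_add_eq_zero_left h0]
    congr 1
    field_simp
  refine ⟨h u ?_, hv⟩
  simpa [hv] using h0

/-- Clearing denominators, a quaternion of norm zero has the form `u + v * y` with `u`, `v`
polynomial in `t`. Its norm equation splits into two polynomial identities, which can be evaluated
in the generic field `M` instead of `L`; there `Aniso.eq_zero_of_quadratic` applies. -/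
theorem Aniso.adjoin_cons (h2 : (2 : K) ≠ 0) {a b : K} (ha : a ≠ 0) (hb : b ≠ 0)
    (h : Aniso a b) {n : ℕ} (hn : 4 ≤ n) (d : Fin n → K) (hd : ∀ i, d i ≠ 0) {t : Fin n → L}
    (ht : AlgebraicIndependent K t) {y : L} (hy : y ^ 2 = ∑ i, algebraMap K L (d i) * t i ^ 2) :
    Aniso (algebraMap K (adjoin K (Set.range (Fin.cons y t : Fin (n + 1) → L))) a)
      (algebraMap K (adjoin K (Set.range (Fin.cons y t : Fin (n + 1) → L))) b) := by
  obtain ⟨M, _, _, t', ht', hM, hne⟩ := exists_generic_ne h2 ha hb h hn d hd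
  have h2M : (2 : M) ≠ 0 := by
    rw [← map_ofNat (algebraMap K M) 2]
    exact (map_ne_zero_iff _ (algebraMap K M).injective).mpr h2
  open scoped IntermediateField.algebraAdjoinAdjoin in
  refine Aniso.fractionRing (R := Algebra.adjoin K (Set.range (Fin.cons y t : Fin (n + 1) → L)))
    (a := algebraMap K _ a) (b := algebraMap K _ b) rfl rfl ?_
  intro q hq
  obtain ⟨p0, q0, e0⟩ := exists_eq_linear d hy q.re.2
  obtain ⟨p1, q1, e1⟩ := exists_eq_linear d hy q.imI.2
  obtain ⟨p2, q2, e2⟩ := exists_eq_linear d hy q.imJ.2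
  obtain ⟨p3, q3, e3⟩ := exists_eq_linear d hy q.imK.2
  let u : ℍ[MvPolynomial (Fin n) K, C a, 0, C b] := ⟨p0, p1, p2, p3⟩
  let v : ℍ[MvPolynomial (Fin n) K, C a, 0, C b] := ⟨q0, q1, q2, q3⟩
  have hq' : aeval t (nrd u + diagPoly d * nrd v) + aeval t (2 * (u * star v).re) * y = 0 := by
    have hqL := congrArg (Subtype.val) hq
    simp only [nrd] at hqL
    push_cast at hqL
    rw [e0, e1, e2, e3] at hqL
    simp only [map_add, map_mul, aeval_diagPoly, ← hy]
    simp only [nrd, u, v, map_add, map_sub, map_mul, map_pow, aeval_C, QuaternionAlgebra.re_mul,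
      QuaternionAlgebra.re_star, QuaternionAlgebra.imI_star, QuaternionAlgebra.imJ_star,
      QuaternionAlgebra.imK_star, map_neg, map_ofNat, map_zero]
    linear_combination hqL
  obtain ⟨h0, h1⟩ := h.eq_zero_of_linear h2 ha hb hn d hd ht hy hq'
  have hC : ∀ x : K, (aeval t' : MvPolynomial (Fin n) K →ₐ[K] M).toRingHom (C x) = algebraMap K M x :=
    fun x => aeval_C _ _
  have hz := hM.eq_zero_of_quadratic h2M hne (u := qmap _ (hC a) (hC b) u)
    (v := qmap _ (hC a) (hC b) v) (by
      rw [nrd_qmap, nrd_qmap, ← aeval_diagPoly]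
      simpa using congrArg (aeval t') h0) (by
      simpa [u, v] using congrArg (aeval t') h1)
  have hinj := qmap_injective _ (hC a) (hC b) ht'
  have hu : u = 0 := hinj (by rw [hz.1, map_zero])
  have hv : v = 0 := hinj (by rw [hz.2, map_zero])
  have hu' := QuaternionAlgebra.ext_iff.mp hu
  have hv' := QuaternionAlgebra.ext_iff.mp hv
  simp only [u, v, QuaternionAlgebra.re_zero, QuaternionAlgebra.imI_zero,
    QuaternionAlgebra.imJ_zero, QuaternionAlgebra.imK_zero] at hu' hv'
  ext
  · simp [e0, hu', hv']
  · simp [e1, hu', hv']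
  · simp [e2, hu', hv']
  · simp [e3, hu', hv']

theorem formPolynomial_weightedSumSquares {r : ℕ} (w : Fin r → K) :
    formPolynomial (QuadraticMap.weightedSumSquares K w) = diagPoly w := by
  have h1 : ∀ i, QuadraticMap.weightedSumSquares K w (Pi.single i 1) = w i := fun i => by
    rw [QuadraticMap.weightedSumSquares_apply, Finset.sum_eq_single i] <;> simp +contextual
  have h2 : ∀ i, ∀ j ∈ Finset.Ioi i, QuadraticMap.polar (QuadraticMap.weightedSumSquares K w)
      (Pi.single i 1) (Pi.single j 1) = 0 := fun i j hj => by
    have hij : i ≠ j := (Finset.mem_Ioi.mp hj).ne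
    rw [QuadraticMap.polar, h1, h1, QuadraticMap.weightedSumSquares_apply]
    rw [← Finset.add_sum_erase _ _ (Finset.mem_univ i),
      ← Finset.add_sum_erase _ _ (Finset.mem_erase.mpr ⟨hij.symm, Finset.mem_univ j⟩),
      Finset.sum_eq_zero]
    · simp [hij, hij.symm]
    · intro l hl
      simp only [Finset.mem_erase] at hl
      simp [hl.1, hl.2.1]
  rw [formPolynomial, diagPoly, Finset.sum_eq_zero (s := Finset.univ)
    (f := fun i => ∑ j ∈ Finset.Ioi i, _), add_zero]
  · simp_rw [h1]
  · intro i _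
    exact Finset.sum_eq_zero fun j hj => by rw [h2 i j hj]; simp

theorem map_diagPoly {F : Type*} [Field F] [Algebra F K] {n : ℕ} (w : Fin (n + 1) → F)
    (hw : w 0 ≠ 0) : MvPolynomial.map (algebraMap F K) (diagPoly w) =
      C (algebraMap F K (w 0)) * (X 0 ^ 2 - rename Fin.succ
        (diagPoly fun i => algebraMap F K (-(w i.succ / w 0)))) := by
  have hw' : algebraMap F K (w 0) ≠ 0 := (map_ne_zero_iff _ (algebraMap F K).injective).mpr hw
  simp only [diagPoly, map_sum, map_mul, map_pow, map_X, map_C, rename_X, rename_C]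
  rw [Fin.sum_univ_succ, mul_sub, Finset.mul_sum, sub_eq_add_neg, ← Finset.sum_neg_distrib]
  congr 1
  refine Finset.sum_congr rfl fun i _ => ?_
  have hi : algebraMap F K (w i.succ) =
      -(algebraMap F K (w 0) * algebraMap F K (-(w i.succ / w 0))) := by
    rw [map_neg, map_div₀, mul_neg, neg_neg, mul_div_cancel₀ _ hw']
  rw [hi, C_neg, C_mul]
  ring

theorem Aniso.nonempty_algEquiv_bigFunctionField {F L : Type u} [Field F] [Algebra F K] [Field L]
    [Algebra K L] (h2 : (2 : K) ≠ 0) {a b : K} (ha : a ≠ 0) (hb : b ≠ 0)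
    (h : Aniso a b) {n : ℕ} (hn : 4 ≤ n) (w : Fin (n + 1) → F) (hw : ∀ i, w i ≠ 0) {t : Fin n → L}
    (ht : AlgebraicIndependent K t) {y : L}
    (hy : y ^ 2 = ∑ i, algebraMap K L (algebraMap F K (-(w i.succ / w 0))) * t i ^ 2) :
    Nonempty (adjoin K (Set.range (Fin.cons y t : Fin (n + 1) → L)) ≃ₐ[K]
      BigFunctionField K (QuadraticMap.weightedSumSquares F w)) := by
  have hker : RingHom.ker (aeval (R := K) (Fin.cons y t : Fin (n + 1) → L)) =
      Ideal.span {MvPolynomial.map (algebraMap F K)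
        (formPolynomial (QuadraticMap.weightedSumSquares F w))} := by
    rw [formPolynomial_weightedSumSquares, map_diagPoly w (hw 0)]
    refine h.ker_aeval_cons h2 ha hb hn ?_ _ (fun i => ?_) ht hy
    · exact (map_ne_zero_iff _ (algebraMap F K).injective).mpr (hw 0)
    · exact (map_ne_zero_iff _ (algebraMap F K).injective).mpr
        (neg_ne_zero.mpr (div_ne_zero (hw _) (hw 0)))
  let e : (MvPolynomial (Fin (n + 1)) K ⧸ Ideal.span {MvPolynomial.map (algebraMap F K)
        (formPolynomial (QuadraticMap.weightedSumSquares F w))}) ≃ₐ[K]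
      Algebra.adjoin K (Set.range (Fin.cons y t : Fin (n + 1) → L)) :=
    ((Ideal.quotientEquivAlgOfEq K hker.symm).trans
      (Ideal.quotientKerEquivRange _)).trans
      (Subalgebra.equivOfEq _ _ (Algebra.adjoin_range_eq_range_aeval K _).symm)
  open scoped IntermediateField.algebraAdjoinAdjoin in
  exact ⟨IsFractionRing.algEquivOfAlgEquiv e.symm⟩

end FunctionField

/-! ### Independent generic zeros and the tower they generate. -/

section Tower

open IntermediateField

/-- Expressing anisotropy over `E` inside the fixed algebra over `L` allows equal intermediate
fields to be exchanged by rewriting. -/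
theorem aniso_intermediateField_iff {K L : Type*} [Field K] [Field L] [Algebra K L]
    {E : IntermediateField K L} {a b : E} {a' b' : L} (ha : algebraMap E L a = a')
    (hb : algebraMap E L b = b') : Aniso a b ↔ ∀ q : ℍ[L, a', 0, b'],
      q.re ∈ E → q.imI ∈ E → q.imJ ∈ E → q.imK ∈ E → nrd q = 0 → q = 0 := by
  have hinj := qmap_injective (algebraMap E L) ha hb (algebraMap E L).injective
  constructor
  · intro h q h0 h1 h2 h3 hq
    have hq' : q = qmap (algebraMap E L) ha hb ⟨⟨_, h0⟩, ⟨_, h1⟩, ⟨_, h2⟩, ⟨_, h3⟩⟩ := rfl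
    rw [hq', nrd_qmap, map_eq_zero_iff _ (algebraMap E L).injective] at hq
    rw [hq', h _ hq, map_zero]
  · intro h q hq
    apply hinj
    rw [map_zero]
    exact h _ q.re.2 q.imI.2 q.imJ.2 q.imK.2 (by rw [nrd_qmap, hq, map_zero])

variable {F L P : Type u} [Field F] [Field L] [Algebra F L] {n : ℕ}

/-- Independent generic zeros `(yₚ, tₚ)` in `L` of the diagonal quadratic forms with
coefficients `wₚ`. -/
structure GenericZeros (F L : Type u) [Field F] [Field L] [Algebra F L] {P : Type u} {n : ℕ}
    (w : P → Fin (n + 1) → F) where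
  /-- The algebraically independent coordinates. -/
  t : P × Fin n → L
  /-- The algebraic coordinates. -/
  y : P → L
  algebraicIndependent : AlgebraicIndependent F t
  sq_eq : ∀ p, y p ^ 2 = ∑ i, algebraMap F L (-(w p i.succ / w p 0)) * t (p, i) ^ 2

namespace GenericZeros

variable {w : P → Fin (n + 1) → F} (G : GenericZeros F L w)

/-- The coordinates of the zero with index `p`. -/
def zero (p : P) : Fin (n + 1) → L := Fin.cons (G.y p) fun i => G.t (p, i)

/-- The field generated by the coordinates of the zeros with index in `A`. -/
def field (A : Set P) : IntermediateField F L := adjoin F (⋃ p ∈ A, Set.range (G.zero p))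

theorem zero_mem_field {A : Set P} {p : P} (hp : p ∈ A) (i : Fin (n + 1)) :
    G.zero p i ∈ G.field A :=
  subset_adjoin F _ (Set.mem_biUnion hp ⟨i, rfl⟩)

theorem field_mono {A B : Set P} (h : A ⊆ B) : G.field A ≤ G.field B :=
  adjoin.mono F _ _ (Set.biUnion_subset_biUnion_left h)

theorem isAlgebraic_of_mem_field {A : Set P} {x : L} (hx : x ∈ G.field A) :
    IsAlgebraic (adjoin F (G.t '' {q | q.1 ∈ A})) x := by
  have hle : G.field A ≤
      (algebraicClosure (adjoin F (G.t '' {q | q.1 ∈ A})) L).restrictScalars F := by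
    rw [field, adjoin_le_iff]
    intro z hz
    obtain ⟨p, hp, i, rfl⟩ := Set.mem_iUnion₂.mp hz
    have ht : ∀ i, G.t (p, i) ∈ adjoin F (G.t '' {q | q.1 ∈ A}) := fun i =>
      subset_adjoin F _ ⟨(p, i), hp, rfl⟩
    have hY : G.y p ^ 2 ∈ adjoin F (G.t '' {q | q.1 ∈ A}) := by
      rw [G.sq_eq]
      exact sum_mem fun i _ => mul_mem (_root_.algebraMap_mem _ _) (pow_mem (ht i) 2)
    change _ ∈ algebraicClosure (adjoin F (G.t '' {q | q.1 ∈ A})) L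
    rw [mem_algebraicClosure_iff]
    refine Fin.cases ?_ (fun i => ?_) i
    · refine IsAlgebraic.of_pow two_pos ?_
      exact isAlgebraic_algebraMap (A := L) (⟨_, hY⟩ : adjoin F (G.t '' {q | q.1 ∈ A}))
    · exact isAlgebraic_algebraMap (A := L) (⟨_, ht i⟩ : adjoin F (G.t '' {q | q.1 ∈ A}))
  exact mem_algebraicClosure_iff.mp (hle hx)

theorem adjoin_le_field (A : Set P) : adjoin F (G.t '' {q | q.1 ∈ A}) ≤ G.field A := by
  rw [adjoin_le_iff]
  rintro _ ⟨⟨p, i⟩, hp, rfl⟩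
  exact G.zero_mem_field hp i.succ

/-- The field of the zeros in `A` is algebraic over the one generated by their coordinates `t`, and
algebraic independence survives algebraic extension of the base. -/
theorem algebraicIndependent_field {A : Set P} {p : P} (hp : p ∉ A) :
    AlgebraicIndependent (G.field A) fun i => G.t (p, i) := by
  have hd : Disjoint {q : P × Fin n | q.1 ∈ A} {q : P × Fin n | q.1 = p} :=
    Set.disjoint_left.mpr fun q hq hq' => hp (hq' ▸ hq)
  have h1 := algebraicIndependent_adjoin_iff.mpr (G.algebraicIndependent.adjoin_of_disjoint hd)
  have h2 := h1.comp (fun i : Fin n => (⟨(p, i), rfl⟩ : {q : P × Fin n | q.1 = p}))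
    fun i j hij => by simpa using hij
  let := (inclusion (G.adjoin_le_field A)).toAlgebra
  have : IsScalarTower (adjoin F (G.t '' {q | q.1 ∈ A})) (G.field A) L :=
    IsScalarTower.of_algebraMap_eq fun _ => rfl
  have : Algebra.IsAlgebraic (adjoin F (G.t '' {q | q.1 ∈ A})) (G.field A) :=
    ⟨fun x => (isAlgebraic_algebraMap_iff (algebraMap (G.field A) L).injective).mp
      (G.isAlgebraic_of_mem_field x.2)⟩
  exact h2.extendScalars (G.field A)

theorem sq_eq_field (A : Set P) (p : P) : G.y p ^ 2 = ∑ i, algebraMap (G.field A) L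
    (algebraMap F (G.field A) (-(w p i.succ / w p 0))) * G.t (p, i) ^ 2 :=
  G.sq_eq p

theorem restrictScalars_adjoin_zero (A : Set P) (p : P) :
    (adjoin (G.field A) (Set.range (G.zero p))).restrictScalars F = G.field (insert p A) := by
  rw [field, adjoin_adjoin_left, field, Set.biUnion_insert, Set.union_comm]

theorem field_empty : G.field ∅ = ⊥ := by
  simp [field]

theorem aniso_field_finset (h2 : (2 : F) ≠ 0) {a b : F} (ha : a ≠ 0) (hb : b ≠ 0)
    (h : Aniso a b) (hn : 4 ≤ n) (hw : ∀ p i, w p i ≠ 0) (T : Finset P) :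
    Aniso (algebraMap F (G.field T) a) (algebraMap F (G.field T) b) := by
  classical
  induction T using Finset.induction_on with
  | empty =>
    rw [Finset.coe_empty, aniso_intermediateField_iff (a' := algebraMap F L a)
      (b' := algebraMap F L b) rfl rfl, field_empty]
    intro q h0 h1 h2 h3 hq
    rw [mem_bot] at h0 h1 h2 h3
    obtain ⟨x0, h0⟩ := h0
    obtain ⟨x1, h1⟩ := h1
    obtain ⟨x2, h2⟩ := h2
    obtain ⟨x3, h3⟩ := h3
    have hq' : q = qmap (algebraMap F L) rfl rfl (⟨x0, x1, x2, x3⟩ : ℍ[F, a, 0, b]) := by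
      ext
      · exact h0.symm
      · exact h1.symm
      · exact h2.symm
      · exact h3.symm
    have hz : nrd (⟨x0, x1, x2, x3⟩ : ℍ[F, a, 0, b]) = 0 := by
      apply (algebraMap F L).injective
      rw [map_zero, ← hq, hq', nrd_qmap]
    rw [hq', h _ hz, map_zero]
  | insert p T hp ih =>
    have hinj := (algebraMap F (G.field T)).injective
    have := ih.adjoin_cons (L := L) (by
      rw [← map_ofNat (algebraMap F (G.field T)) 2]
      exact (map_ne_zero_iff _ hinj).mpr h2)
      ((map_ne_zero_iff _ hinj).mpr ha) ((map_ne_zero_iff _ hinj).mpr hb) hn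
      _ (fun i => (map_ne_zero_iff _ hinj).mpr (neg_ne_zero.mpr (div_ne_zero (hw p i.succ) (hw p 0))))
      (G.algebraicIndependent_field (by simpa using hp)) (G.sq_eq_field T p)
    rw [aniso_intermediateField_iff (a' := algebraMap F L a) (b' := algebraMap F L b) rfl rfl]
      at this ⊢
    rw [Finset.coe_insert, ← restrictScalars_adjoin_zero]
    exact this

/-- The four coordinates of a quaternion over `L` involve only finitely many zeros, so the finite
case suffices. -/
theorem aniso (h2 : (2 : F) ≠ 0) {a b : F} (ha : a ≠ 0) (hb : b ≠ 0)
    (h : Aniso a b) (hn : 4 ≤ n) (hw : ∀ p i, w p i ≠ 0) (htop : G.field Set.univ = ⊤) :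
    Aniso (algebraMap F L a) (algebraMap F L b) := by
  classical
  have hT : ∀ x : L, ∃ T : Finset P, x ∈ G.field T := fun x => by
    have hx : x ∈ G.field Set.univ := htop ▸ mem_top
    rw [field, Set.biUnion_univ, adjoin_iUnion] at hx
    obtain ⟨T, hT⟩ := exists_finset_of_mem_iSup hx
    refine ⟨T, SetLike.le_def.mp (iSup₂_le fun p hp => ?_) hT⟩
    rw [adjoin_le_iff]
    rintro _ ⟨i, rfl⟩
    exact G.zero_mem_field (by simpa using hp) i
  intro q hq
  obtain ⟨T0, h0⟩ := hT q.re
  obtain ⟨T1, h1⟩ := hT q.imI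
  obtain ⟨T2, h2'⟩ := hT q.imJ
  obtain ⟨T3, h3⟩ := hT q.imK
  have hA := G.aniso_field_finset h2 ha hb h hn hw (T0 ∪ T1 ∪ (T2 ∪ T3))
  rw [aniso_intermediateField_iff (a' := algebraMap F L a) (b' := algebraMap F L b) rfl rfl] at hA
  exact hA q (G.field_mono (by intro x hx; simp_all) h0) (G.field_mono (by intro x hx; simp_all) h1)
    (G.field_mono (by intro x hx; simp_all) h2') (G.field_mono (by intro x hx; simp_all) h3) hq

theorem exists_algEquiv_bigFunctionField (h2 : (2 : F) ≠ 0) {a b : F} (ha : a ≠ 0) (hb : b ≠ 0)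
    (h : Aniso (algebraMap F L a) (algebraMap F L b)) (hn : 4 ≤ n) (hw : ∀ p i, w p i ≠ 0)
    {A : Set P} {p : P} (hp : p ∉ A) {S K : IntermediateField F L} (hS : S = G.field A)
    (hK : K = G.field (insert p A)) : ∃ h : S ≤ K, Nonempty (extendScalars h ≃ₐ[S]
      BigFunctionField S (QuadraticMap.weightedSumSquares F (w p))) := by
  subst hS hK
  have hle : G.field A ≤ G.field (insert p A) := G.field_mono (Set.subset_insert _ _)
  refine ⟨hle, ?_⟩
  have hinj := (algebraMap F (G.field A)).injective
  have hE : extendScalars hle = adjoin (G.field A) (Set.range (G.zero p)) := by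
    apply restrictScalars_injective F
    rw [extendScalars_restrictScalars, restrictScalars_adjoin_zero]
  have hA : Aniso (algebraMap F (G.field A) a) (algebraMap F (G.field A) b) :=
    Aniso.of_map (algebraMap (G.field A) L) rfl rfl (algebraMap (G.field A) L).injective h
  obtain ⟨e⟩ := hA.nonempty_algEquiv_bigFunctionField (L := L) (by
      rw [← map_ofNat (algebraMap F (G.field A)) 2]
      exact (map_ne_zero_iff _ hinj).mpr h2)
      ((map_ne_zero_iff _ hinj).mpr ha) ((map_ne_zero_iff _ hinj).mpr hb) hn
      (w p) (hw p) (G.algebraicIndependent_field hp) (G.sq_eq_field A p)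
  exact ⟨(equivOfEq hE).trans e⟩

/-- Used with `A p` the indices up to `p`, and `B` either a proper initial segment or everything: it
identifies the unions in the tower. -/
theorem biUnion_field (B : Set P) (A : P → Set P) (hA : ∀ p ∈ B, p ∈ A p)
    (hAB : ∀ p ∈ B, A p ⊆ B) : ⨆ p : B, G.field (A p) = G.field B := by
  refine le_antisymm (iSup_le fun p => G.field_mono (hAB p p.2)) ?_
  nth_rewrite 1 [field]
  rw [adjoin_le_iff]
  intro z hz
  obtain ⟨p, hp, i, rfl⟩ := Set.mem_iUnion₂.mp hz
  exact SetLike.le_def.mp (le_iSup (fun p : B => G.field (A p)) ⟨p, hp⟩)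
    (G.zero_mem_field (hA p hp) i)

/-- The zeros, as elements of the field that they generate. -/
def restrict : GenericZeros F (G.field Set.univ) w where
  t q := ⟨G.t q, G.zero_mem_field (Set.mem_univ q.1) q.2.succ⟩
  y p := ⟨G.y p, G.zero_mem_field (Set.mem_univ p) 0⟩
  algebraicIndependent := AlgebraicIndependent.of_comp (G.field Set.univ).val G.algebraicIndependent
  sq_eq p := by
    apply (algebraMap (G.field Set.univ) L).injective
    rw [map_pow, map_sum]
    refine (G.sq_eq p).trans (Finset.sum_congr rfl fun i _ => ?_)
    rw [map_mul, map_pow, ← IsScalarTower.algebraMap_apply]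
    rfl

theorem restrict_field_univ : G.restrict.field Set.univ = ⊤ := by
  apply map_injective (G.field Set.univ).val
  change (adjoin F (⋃ p ∈ Set.univ, Set.range (G.restrict.zero p))).map _ = _
  rw [adjoin_map, ← AlgHom.fieldRange_eq_map, fieldRange_val]
  simp only [Set.image_iUnion, ← Set.range_comp]
  refine congrArg (adjoin F) (Set.iUnion₂_congr fun p _ => congrArg Set.range (funext fun i => ?_))
  refine Fin.cases rfl (fun i => rfl) i

end GenericZeros

theorem exists_genericZeros (w : P → Fin (n + 1) → F) :
    ∃ (L : Type u) (_ : Field L) (_ : Algebra F L) (G : GenericZeros F L w),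
      G.field Set.univ = ⊤ := by
  let E := FractionRing (MvPolynomial (P × Fin n) F)
  let Ω := AlgebraicClosure E
  have ht : AlgebraicIndependent F fun i : P × Fin n =>
      algebraMap E Ω (algebraMap (MvPolynomial (P × Fin n) F) E (MvPolynomial.X i)) := by
    have h1 := (MvPolynomial.algebraicIndependent_X (P × Fin n) F).map'
      (f := IsScalarTower.toAlgHom F (MvPolynomial (P × Fin n) F) E) (IsFractionRing.injective _ _)
    exact h1.map' (f := IsScalarTower.toAlgHom F E Ω) (algebraMap E Ω).injective
  choose y hy using fun p => IsAlgClosed.exists_pow_nat_eq (∑ i : Fin n,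
    algebraMap F Ω (-(w p i.succ / w p 0)) *
      (algebraMap E Ω (algebraMap (MvPolynomial (P × Fin n) F) E (MvPolynomial.X (p, i)))) ^ 2)
    two_pos
  let G : GenericZeros F Ω w := ⟨_, y, ht, hy⟩
  exact ⟨_, inferInstance, inferInstance, G.restrict, G.restrict_field_univ⟩

end Tower

/-! ### Presentations of quaternion algebras and base change. -/

section Quaternion

variable {K : Type u} [Field K]

theorem aniso_iff_isUnit {D : Type v} [Ring D] [Algebra K D] {a b : K}
    (e : D ≃ₐ[K] ℍ[K, a, 0, b]) : Aniso a b ↔ ∀ x : D, x ≠ 0 → IsUnit x := by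
  constructor
  · intro h x hx
    have hn : nrd (e x) ≠ 0 := fun hn => hx ((map_eq_zero_iff _ e.injective).mp (h _ hn))
    have hu : IsUnit (algebraMap K ℍ[K, a, 0, b] (nrd (e x))) := (IsUnit.mk0 _ hn).map _
    rw [← isUnit_map_iff e]
    refine isUnit_iff_exists.mpr ⟨star (e x) * algebraMap K _ (nrd (e x))⁻¹, ?_, ?_⟩
    · rw [← mul_assoc, mul_star_eq_nrd, ← map_mul, mul_inv_cancel₀ hn, map_one]
    · rw [← Algebra.commutes, mul_assoc, star_mul_eq_nrd, ← map_mul, inv_mul_cancel₀ hn, map_one]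
  · intro h q hq
    by_contra hq0
    have hu : IsUnit q := by
      rw [← e.apply_symm_apply q, isUnit_map_iff]
      exact h _ fun h0 => hq0 (by rw [← e.apply_symm_apply q, h0, map_zero])
    have hs : star q = 0 := hu.mul_right_eq_zero.mp (by rw [mul_star_eq_nrd, hq, map_zero])
    exact hq0 (star_eq_zero.mp hs)

theorem isQuaternionDivision_iff {D : Type v} [Ring D] [Algebra K D] {a b : Kˣ}
    (h : HasSymbol K D a b) : IsQuaternionDivision K D ↔ Aniso (a : K) (b : K) := by
  obtain ⟨e⟩ := id h
  rw [aniso_iff_isUnit e, IsQuaternionDivision, and_iff_right ⟨a, b, h⟩]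

theorem HasSymbol.congr {D D' : Type*} [Ring D] [Algebra K D] [Ring D'] [Algebra K D'] {a b : Kˣ}
    (e : D ≃ₐ[K] D') (h : HasSymbol K D a b) : HasSymbol K D' a b :=
  h.map e.symm.trans

theorem liftHom_apply {D : Type v} [Ring D] [Algebra K D] {c f : K}
    (B : QuaternionAlgebra.Basis D c 0 f) (q : ℍ[K, c, 0, f]) :
    B.liftHom q = algebraMap K D q.re + q.imI • B.i + q.imJ • B.j + q.imK • B.k :=
  rfl

theorem liftHom_i {D : Type v} [Ring D] [Algebra K D] {c f : K}
    (B : QuaternionAlgebra.Basis D c 0 f) : B.liftHom ⟨0, 1, 0, 0⟩ = B.i := by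
  rw [liftHom_apply]
  simp

theorem liftHom_j {D : Type v} [Ring D] [Algebra K D] {c f : K}
    (B : QuaternionAlgebra.Basis D c 0 f) : B.liftHom ⟨0, 0, 1, 0⟩ = B.j := by
  rw [liftHom_apply]
  simp

/-- The maps in both directions come from universal properties, and their composites are identities
because they fix the generators i and j. -/
theorem HasSymbol.baseChange {L : Type*} [Field L] [Algebra K L] {D : Type v} [Ring D] [Algebra K D]
    {a b : Kˣ} (h : HasSymbol K D a b) : HasSymbol L (L ⊗[K] D)
      (Units.map (algebraMap K L).toMonoidHom a) (Units.map (algebraMap K L).toMonoidHom b) := by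
  obtain ⟨e⟩ := h
  let B : QuaternionAlgebra.Basis (L ⊗[K] ℍ[K, (a : K), 0, (b : K)]) (algebraMap K L a) 0
      (algebraMap K L b) :=
    { i := 1 ⊗ₜ ⟨0, 1, 0, 0⟩
      j := 1 ⊗ₜ ⟨0, 0, 1, 0⟩
      k := 1 ⊗ₜ ⟨0, 0, 0, 1⟩
      i_mul_i := by
        rw [Algebra.TensorProduct.tmul_mul_tmul, zero_smul, add_zero, algebraMap_smul,
          Algebra.TensorProduct.one_def, ← TensorProduct.tmul_smul, mul_one]
        congr 1
        ext <;> simp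
      j_mul_j := by
        rw [Algebra.TensorProduct.tmul_mul_tmul, algebraMap_smul,
          Algebra.TensorProduct.one_def, ← TensorProduct.tmul_smul, mul_one]
        congr 1
        ext <;> simp
      i_mul_j := by
        rw [Algebra.TensorProduct.tmul_mul_tmul, mul_one]
        congr 1
        ext <;> simp
      j_mul_i := by
        rw [Algebra.TensorProduct.tmul_mul_tmul, mul_one, zero_smul, zero_sub,
          ← TensorProduct.tmul_neg]
        congr 1
        ext <;> simp }
  let g : ℍ[K, (a : K), 0, (b : K)] →ₐ[K] ℍ[L, algebraMap K L a, 0, algebraMap K L b] :=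
    { qmap (algebraMap K L) rfl rfl with
      commutes' := fun r => qmap_algebraMap (algebraMap K L) rfl rfl r }
  let G : L ⊗[K] ℍ[K, (a : K), 0, (b : K)] →ₐ[L] ℍ[L, algebraMap K L a, 0, algebraMap K L b] :=
    Algebra.TensorProduct.lift (Algebra.ofId L _) g fun x y => Algebra.commutes x (g y)
  have hBi : B.liftHom ⟨0, 1, 0, 0⟩ = 1 ⊗ₜ ⟨0, 1, 0, 0⟩ := liftHom_i B
  have hBj : B.liftHom ⟨0, 0, 1, 0⟩ = 1 ⊗ₜ ⟨0, 0, 1, 0⟩ := liftHom_j B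
  have hgi : g ⟨0, 1, 0, 0⟩ = ⟨0, 1, 0, 0⟩ := by
    change qmap (algebraMap K L) rfl rfl _ = _
    ext <;> simp
  have hgj : g ⟨0, 0, 1, 0⟩ = ⟨0, 0, 1, 0⟩ := by
    change qmap (algebraMap K L) rfl rfl _ = _
    ext <;> simp
  have hG : ∀ x, G (1 ⊗ₜ x) = g x := fun x =>
    (Algebra.TensorProduct.lift_tmul _ _ _ _ _).trans (by rw [map_one, one_mul])
  have h1 : G.comp B.liftHom = AlgHom.id L _ := by
    apply QuaternionAlgebra.hom_ext
    · change G (B.liftHom ⟨0, 1, 0, 0⟩) = ⟨0, 1, 0, 0⟩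
      rw [hBi, hG, hgi]
    · change G (B.liftHom ⟨0, 0, 1, 0⟩) = ⟨0, 0, 1, 0⟩
      rw [hBj, hG, hgj]
  have h2 : B.liftHom.comp G = AlgHom.id L _ := by
    apply Algebra.TensorProduct.ext
    · ext
    · apply QuaternionAlgebra.hom_ext
      · change B.liftHom (G (1 ⊗ₜ ⟨0, 1, 0, 0⟩)) = 1 ⊗ₜ ⟨0, 1, 0, 0⟩
        rw [hG, hgi, hBi]
      · change B.liftHom (G (1 ⊗ₜ ⟨0, 0, 1, 0⟩)) = 1 ⊗ₜ ⟨0, 0, 1, 0⟩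
        rw [hG, hgj, hBj]
  exact ⟨(Algebra.TensorProduct.congr AlgEquiv.refl e).trans (AlgEquiv.ofAlgHom G B.liftHom h1 h2)⟩

/-- Anticommuting elements of a quaternion division algebra present it by a symbol. -/
theorem exists_algEquiv_of_anticomm (h2 : (2 : K) ≠ 0) {D : Type v} [Ring D] [Algebra K D]
    (hD : IsQuaternionDivision K D) {x z : D} {c f : K} (hx : ∀ r, x ≠ algebraMap K D r) (hz : z ≠ 0)
    (hxc : x * x = algebraMap K D c) (hzf : z * z = algebraMap K D f) (hxz : x * z = -(z * x)) :
    ∃ e : D ≃ₐ[K] ℍ[K, c, 0, f], e x = ⟨0, 1, 0, 0⟩ := by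
  obtain ⟨⟨a, b, ⟨e⟩⟩, hu⟩ := hD
  have hnz : ∀ p q : D, p * q = 0 → q ≠ 0 → p = 0 := fun p q hpq hq =>
    (hu q hq).mul_left_eq_zero.mp hpq
  have hx0 : x ≠ 0 := by simpa using hx 0
  let B : QuaternionAlgebra.Basis D c 0 f :=
    { i := x
      j := z
      k := x * z
      i_mul_i := by rw [hxc, zero_smul, add_zero, Algebra.algebraMap_eq_smul_one]
      j_mul_j := by rw [hzf, Algebra.algebraMap_eq_smul_one]
      i_mul_j := rfl
      j_mul_i := by rw [hxz, zero_smul, zero_sub, neg_neg] }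
  have hlin : ∀ r s : K, algebraMap K D r + algebraMap K D s * x = 0 → r = 0 ∧ s = 0 := by
    intro r s hrs
    have hs : s = 0 := by
      by_contra hs
      apply hx (-s⁻¹ * r)
      have : algebraMap K D s⁻¹ * (algebraMap K D s * x) = x := by
        rw [← mul_assoc, ← map_mul, inv_mul_cancel₀ hs, map_one, one_mul]
      rw [← this, eq_neg_of_add_eq_zero_right hrs, ← map_neg, ← map_mul]
      congr 1
      ring
    rw [hs, map_zero, zero_mul, add_zero] at hrs
    have : Nontrivial D := ⟨x, 0, hx0⟩
    exact ⟨(map_eq_zero_iff _ (algebraMap K D).injective).mp hrs, hs⟩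
  have hinj : Function.Injective B.liftHom := by
    rw [injective_iff_map_eq_zero]
    intro q hq
    have hq' : (algebraMap K D q.re + algebraMap K D q.imI * x) +
        (algebraMap K D q.imJ + algebraMap K D q.imK * x) * z = 0 := by
      rw [← hq, liftHom_apply]
      simp only [B, Algebra.smul_def, add_mul, mul_assoc, add_assoc]
    obtain ⟨A, hA⟩ : ∃ A, A = algebraMap K D q.re + algebraMap K D q.imI * x := ⟨_, rfl⟩
    obtain ⟨C, hC⟩ : ∃ C, C = algebraMap K D q.imJ + algebraMap K D q.imK * x := ⟨_, rfl⟩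
    have hcomm : ∀ r s : K, x * (algebraMap K D r + algebraMap K D s * x) =
        (algebraMap K D r + algebraMap K D s * x) * x := fun r s => by
      rw [mul_add, add_mul, Algebra.commutes r x, ← mul_assoc, Algebra.commutes s x]
    have hxA : x * A = A * x := hA ▸ hcomm _ _
    have hxC : x * C = C * x := hC ▸ hcomm _ _
    rw [← hA, ← hC] at hq'
    -- Conjugation by `x` fixes `A` and `C` and negates `z`, so `A + C * z` and `A - C * z` vanish
    -- together.
    have hsub : A - C * z = 0 := by
      refine hnz _ x ?_ hx0
      have : x * (A + C * z) = 0 := by rw [hq', mul_zero]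
      rw [mul_add, hxA, ← mul_assoc, hxC, mul_assoc, hxz, mul_neg, ← sub_eq_add_neg] at this
      rw [sub_mul, mul_assoc, this]
    have hA0 : A = 0 := by
      have : (2 : K) • A = 0 := by
        rw [two_smul]
        calc A + A = (A + C * z) + (A - C * z) := by abel
          _ = 0 := by rw [hq', hsub, add_zero]
      exact (smul_eq_zero_iff_right h2).mp this
    have hC0 : C = 0 := hnz _ z (by rw [hA0, zero_sub, neg_eq_zero] at hsub; exact hsub) hz
    obtain ⟨h0, h1⟩ := hlin _ _ (hA ▸ hA0)
    obtain ⟨h2, h3⟩ := hlin _ _ (hC ▸ hC0)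
    exact QuaternionAlgebra.ext h0 h1 h2 h3
  have hbij : Function.Bijective B.liftHom := by
    have : FiniteDimensional K D := Module.Finite.equiv e.symm.toLinearEquiv
    have hf : Module.finrank K ℍ[K, c, 0, f] = Module.finrank K D := by
      rw [QuaternionAlgebra.finrank_eq_four, e.toLinearEquiv.finrank_eq,
        QuaternionAlgebra.finrank_eq_four]
    exact ⟨hinj, (LinearMap.injective_iff_surjective_of_finrank_eq_finrank
      (f := B.liftHom.toLinearMap) hf).mp hinj⟩
  refine ⟨(AlgEquiv.ofBijective B.liftHom hbij).symm, ?_⟩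
  rw [AlgEquiv.symm_apply_eq]
  exact (liftHom_i B).symm

/-- A non-central square root of `c` is part of a presentation by a symbol. -/
theorem exists_algEquiv_of_sq (h2 : (2 : K) ≠ 0) {D : Type v} [Ring D] [Algebra K D]
    (hD : IsQuaternionDivision K D) {x : D} {c : K} (hx : ∀ r, x ≠ algebraMap K D r)
    (hxc : x * x = algebraMap K D c) :
    ∃ (c' f : Kˣ) (_ : c' = c) (e : D ≃ₐ[K] ℍ[K, (c' : K), 0, (f : K)]), e x = ⟨0, 1, 0, 0⟩ := by
  obtain ⟨⟨a, b, ⟨e⟩⟩, hu⟩ := id hD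
  have hA : Aniso (a : K) (b : K) := (aniso_iff_isUnit e).mpr hu
  have : Nontrivial D := ⟨x, 0, by simpa using hx 0⟩
  have hx0 : x ≠ 0 := by simpa using hx 0
  have hinj := (algebraMap K D).injective
  have hne : ∀ (z : D) (f : K), z ≠ 0 → z * z = algebraMap K D f → f ≠ 0 := by
    rintro z f hz hzf rfl
    rw [map_zero] at hzf
    exact hz ((hu z hz).mul_left_eq_zero.mp hzf)
  obtain ⟨w, hw⟩ : ∃ w, x * w ≠ w * x := by
    by_contra! hall
    have hc : ∀ v, e x * v = v * e x := fun v => by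
      rw [← e.apply_symm_apply v, ← map_mul, hall, map_mul]
    have hi := QuaternionAlgebra.ext_iff.mp (hc ⟨0, 1, 0, 0⟩)
    have hj := QuaternionAlgebra.ext_iff.mp (hc ⟨0, 0, 1, 0⟩)
    simp only [QuaternionAlgebra.re_mul, QuaternionAlgebra.imI_mul, QuaternionAlgebra.imJ_mul,
      QuaternionAlgebra.imK_mul] at hi hj
    have hJ : (e x).imJ = 0 := by
      apply mul_left_cancel₀ h2
      linear_combination -hi.2.2.2
    have hI : (e x).imI = 0 := by
      apply mul_left_cancel₀ h2
      linear_combination hj.2.2.2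
    have hK : (e x).imK = 0 := by
      apply mul_left_cancel₀ (mul_ne_zero h2 a.ne_zero)
      linear_combination -hi.2.2.1
    refine hx (e x).re (e.injective ?_)
    rw [AlgEquiv.commutes]
    exact eq_algebraMap_of_im_eq_zero (by simp [hI, hJ, hK])
  -- A commutator with `x` anticommutes with `x`, as `x * x` is central; having trace zero, it also
  -- has scalar square.
  have hz : x * w - w * x ≠ 0 := sub_ne_zero.mpr hw
  have hzz : (x * w - w * x) * (x * w - w * x) =
      algebraMap K D (-nrd (e (x * w - w * x))) := by
    apply e.injective
    rw [map_mul, AlgEquiv.commutes]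
    apply mul_self_of_re_eq_zero
    rw [map_sub, map_mul, map_mul]
    simp only [QuaternionAlgebra.re_sub, QuaternionAlgebra.re_mul]
    ring
  have hxz : x * (x * w - w * x) = -((x * w - w * x) * x) := by
    rw [mul_sub, sub_mul, mul_assoc w x x, ← mul_assoc x x w, hxc, Algebra.commutes, neg_sub,
      mul_assoc]
  obtain ⟨e', he'⟩ := exists_algEquiv_of_anticomm h2 hD hx hz hxc hzz hxz
  exact ⟨Units.mk0 c (hne x c hx0 hxc), Units.mk0 _ (hne _ _ hz hzz), rfl, e', he'⟩

end Quaternion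

/-! ### Linkage as a common slot. -/

section Linked

variable {K : Type u} [Field K]

theorem exists_maximalSubfield (h2 : (2 : K) ≠ 0) {D : Type v} [Ring D] [Algebra K D]
    (hD : IsQuaternionDivision K D) {x : D} {c : K} (hx : ∀ r, x ≠ algebraMap K D r)
    (hxc : x * x = algebraMap K D c) : ∃ E : Subalgebra K D, x ∈ E ∧ IsMaximalSubfield K E ∧
      Nonempty (QuadraticAlgebra K c 0 ≃ₐ[K] E) := by
  have hsq : x * x = c • 1 + (0 : K) • x := by
    rw [hxc, zero_smul, add_zero, Algebra.algebraMap_eq_smul_one]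
  let ψ : QuadraticAlgebra K c 0 →ₐ[K] D := QuadraticAlgebra.lift ⟨x, hsq⟩
  have hψ : ∀ z, ψ z = z.re • 1 + z.im • x := fun _ => rfl
  have hnt : Nontrivial D := ⟨x, 0, by simpa using hx 0⟩
  -- A root `r` of `c` in `K` would give (x + r)(x - r) = 0, making `x` scalar; so the quadratic
  -- algebra is a field.
  have hc : Fact (∀ r : K, r ^ 2 ≠ c + 0 * r) := ⟨fun r hr => by
    have h0 : (x + algebraMap K D r) * (x - algebraMap K D r) = 0 := by
      rw [mul_sub, add_mul, add_mul, hxc, ← Algebra.commutes r x, ← map_mul]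
      rw [zero_mul, add_zero, sq] at hr
      rw [hr]
      abel
    have hne : x - algebraMap K D r ≠ 0 := sub_ne_zero.mpr (hx r)
    have := (hD.2 _ hne).mul_left_eq_zero.mp h0
    exact hx (-r) (by rw [map_neg]; exact eq_neg_of_add_eq_zero_left this)⟩
  have hinj : Function.Injective ψ := ψ.toRingHom.injective
  let e : QuadraticAlgebra K c 0 ≃ₐ[K] ψ.range := AlgEquiv.ofInjective ψ hinj
  have hxE : x ∈ ψ.range := ⟨⟨0, 1⟩, by rw [AlgHom.toRingHom_eq_coe, RingHom.coe_coe, hψ]; simp⟩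
  refine ⟨ψ.range, hxE, ⟨e.symm.toMulEquiv.isField (Field.toIsField _), fun S hS hle s hs => ?_⟩,
    ⟨e⟩⟩
  obtain ⟨c', f, hc', e', he'⟩ := exists_algEquiv_of_sq h2 hD hx hxc
  -- Maximality: a larger field centralizes `x`, and the centralizer of i is spanned by 1 and i.
  have hcomm : s * x = x * s := congrArg Subtype.val (hS.mul_comm ⟨s, hs⟩ ⟨x, hle hxE⟩)
  have hcomm' := congrArg e' hcomm
  rw [map_mul, map_mul, he', QuaternionAlgebra.ext_iff] at hcomm'
  simp only [QuaternionAlgebra.re_mul, QuaternionAlgebra.imI_mul, QuaternionAlgebra.imJ_mul,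
      QuaternionAlgebra.imK_mul] at hcomm'
  have hJ : (e' s).imJ = 0 := by
    apply mul_left_cancel₀ h2
    linear_combination -hcomm'.2.2.2
  have hK : (e' s).imK = 0 := by
    apply mul_left_cancel₀ (mul_ne_zero h2 c'.ne_zero)
    linear_combination -hcomm'.2.2.1
  refine ⟨⟨(e' s).re, (e' s).imI⟩, e'.injective ?_⟩
  rw [AlgHom.toRingHom_eq_coe, RingHom.coe_coe, hψ, map_add, map_smul, map_smul, map_one, he']
  ext <;> simp [hJ, hK]

theorem linked_of_sq (h2 : (2 : K) ≠ 0) {D D' : Type v} [Ring D] [Algebra K D] [Ring D']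
    [Algebra K D'] (hD : IsQuaternionDivision K D) (hD' : IsQuaternionDivision K D') {x : D} {x' : D'}
    {c : K} (hx : ∀ r, x ≠ algebraMap K D r) (hx' : ∀ r, x' ≠ algebraMap K D' r)
    (hxc : x * x = algebraMap K D c) (hxc' : x' * x' = algebraMap K D' c) : Linked K D D' := by
  obtain ⟨E, -, hE, ⟨e⟩⟩ := exists_maximalSubfield h2 hD hx hxc
  obtain ⟨E', -, hE', ⟨e'⟩⟩ := exists_maximalSubfield h2 hD' hx' hxc'
  exact ⟨E, E', hE, hE', ⟨e.symm.trans e'⟩⟩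

theorem HasSymbol.exists_sq {D : Type v} [Ring D] [Algebra K D] {a b : Kˣ}
    (h : HasSymbol K D a b) :
    ∃ x : D, (∀ r, x ≠ algebraMap K D r) ∧ x * x = algebraMap K D a := by
  obtain ⟨e⟩ := h
  refine ⟨e.symm ⟨0, 1, 0, 0⟩, fun r hr => ?_, e.injective ?_⟩
  · rw [AlgEquiv.symm_apply_eq, AlgEquiv.commutes] at hr
    simpa [QuaternionAlgebra.algebraMap_eq] using congrArg QuaternionAlgebra.imI hr
  · rw [map_mul, AlgEquiv.apply_symm_apply, AlgEquiv.commutes]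
    ext <;> simp [QuaternionAlgebra.algebraMap_eq]

/-- The scalars alone are not maximal, as they lie in a quadratic subfield. Removing the real part
of a nonscalar element leaves a pure quaternion, whose square is scalar. -/
theorem IsMaximalSubfield.exists_sq (h2 : (2 : K) ≠ 0) {D : Type v} [Ring D] [Algebra K D]
    (hD : IsQuaternionDivision K D) {E : Subalgebra K D} (hE : IsMaximalSubfield K E) :
    ∃ x ∈ E, (∀ r, x ≠ algebraMap K D r) ∧ ∃ c, x * x = algebraMap K D c := by
  obtain ⟨a, b, hab⟩ := hD.1
  obtain ⟨e⟩ := id hab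
  obtain ⟨z, hz, hzr⟩ : ∃ z ∈ E, ∀ r, z ≠ algebraMap K D r := by
    by_contra! hall
    obtain ⟨x, hx, hxc⟩ := hab.exists_sq
    obtain ⟨E₀, hxE, hE₀, -⟩ := exists_maximalSubfield h2 hD hx hxc
    have hle : E ≤ E₀ := fun z hz => by
      obtain ⟨r, rfl⟩ := hall z hz
      exact E₀.algebraMap_mem r
    obtain ⟨r, hr⟩ := hall x (hE.2 hE₀.1 hle hxE)
    exact hx r hr
  refine ⟨z - algebraMap K D (e z).re, E.sub_mem hz (E.algebraMap_mem _), fun r hr => ?_,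
    -nrd (e (z - algebraMap K D (e z).re)), e.injective ?_⟩
  · apply hzr (r + (e z).re)
    rw [map_add, ← hr, sub_add_cancel]
  · rw [map_mul, AlgEquiv.commutes]
    apply mul_self_of_re_eq_zero
    rw [map_sub, AlgEquiv.commutes]
    simp [QuaternionAlgebra.algebraMap_eq]

/-- Quaternion division algebras are linked if and only if they have symbols with a common slot. -/
theorem linked_iff (h2 : (2 : K) ≠ 0) {D D' : Type v} [Ring D] [Algebra K D] [Ring D']
    [Algebra K D'] (hD : IsQuaternionDivision K D) (hD' : IsQuaternionDivision K D') :
    Linked K D D' ↔ ∃ c f f' : Kˣ, HasSymbol K D c f ∧ HasSymbol K D' c f' := by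
  constructor
  · rintro ⟨E, E', hE, -, ⟨ε⟩⟩
    obtain ⟨x, hxE, hx, c, hxc⟩ := hE.exists_sq h2 hD
    have hx' : ∀ r, (ε ⟨x, hxE⟩ : D') ≠ algebraMap K D' r := fun r hr => by
      apply hx r
      have : ε ⟨x, hxE⟩ = ε (algebraMap K E r) := by
        rw [AlgEquiv.commutes]
        exact Subtype.ext hr
      exact congrArg Subtype.val (ε.injective this)
    have hxc' : (ε ⟨x, hxE⟩ : D') * (ε ⟨x, hxE⟩ : D') = algebraMap K D' c := by
      have h1 : (⟨x, hxE⟩ * ⟨x, hxE⟩ : E) = algebraMap K E c := Subtype.ext hxc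
      have := congrArg ε h1
      rw [map_mul, AlgEquiv.commutes] at this
      exact congrArg Subtype.val this
    obtain ⟨c₁, f, hc, e, -⟩ := exists_algEquiv_of_sq h2 hD hx hxc
    obtain ⟨c₂, f', hc', e', -⟩ := exists_algEquiv_of_sq h2 hD' hx' hxc'
    obtain rfl : c₁ = c₂ := Units.ext (hc.trans hc'.symm)
    exact ⟨c₁, f, f', ⟨e⟩, ⟨e'⟩⟩
  · rintro ⟨c, f, f', h, h'⟩
    obtain ⟨x, hx, hxc⟩ := h.exists_sq
    obtain ⟨x', hx', hyc⟩ := h'.exists_sq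
    exact linked_of_sq h2 hD hD' hx hx' hxc hyc

/-- Pure quaternions with the same nonzero reduced norm generate isomorphic subfields. -/
theorem linked_of_nrd_eq (h2 : (2 : K) ≠ 0) {D D' : Type v} [Ring D] [Algebra K D] [Ring D']
    [Algebra K D'] {a b a' b' : Kˣ} (h : HasSymbol K D a b) (h' : HasSymbol K D' a' b')
    (hD : IsQuaternionDivision K D) (hD' : IsQuaternionDivision K D')
    {q : ℍ[K, (a : K), 0, (b : K)]} {q' : ℍ[K, (a' : K), 0, (b' : K)]} (hq : q.re = 0)
    (hq' : q'.re = 0) (hn : nrd q = nrd q') (h0 : q ≠ 0 ∨ q' ≠ 0) : Linked K D D' := by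
  have hA := (isQuaternionDivision_iff h).mp hD
  have hA' := (isQuaternionDivision_iff h').mp hD'
  have hq0 : q ≠ 0 := fun e => h0.elim (fun h => h e) fun h => h (hA' q' (by rw [← hn, e, nrd_zero]))
  have hq0' : q' ≠ 0 := fun e => h0.elim (fun h => h (hA q (by rw [hn, e, nrd_zero]))) fun h => h e
  obtain ⟨e⟩ := h
  obtain ⟨e'⟩ := h'
  have key : ∀ {a b : K} {p : ℍ[K, a, 0, b]}, p.re = 0 → p ≠ 0 → ∀ r, p ≠ algebraMap K _ r := by
    rintro a b p hp hp0 r rfl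
    rw [QuaternionAlgebra.algebraMap_eq] at hp
    exact hp0 (by rw [show r = 0 from hp, map_zero])
  refine linked_of_sq h2 hD hD' (x := e.symm q) (x' := e'.symm q') (c := -nrd q) (fun r hr => ?_)
    (fun r hr => ?_) (e.injective ?_) (e'.injective ?_)
  · rw [AlgEquiv.symm_apply_eq, AlgEquiv.commutes] at hr
    exact key hq hq0 r hr
  · rw [AlgEquiv.symm_apply_eq, AlgEquiv.commutes] at hr
    exact key hq' hq0' r hr
  · rw [map_mul, AlgEquiv.apply_symm_apply, AlgEquiv.commutes, mul_self_of_re_eq_zero hq]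
  · rw [map_mul, AlgEquiv.apply_symm_apply, AlgEquiv.commutes, mul_self_of_re_eq_zero hq', hn]

end Linked

/-! ### Isometry of norm forms for algebras with a common slot. -/

section Isometry

variable {K : Type u} [Field K]

theorem normForm_apply (a b : Kˣ) (v : Fin 4 → K) :
    normForm a b v = nrd (⟨v 0, v 1, v 2, v 3⟩ : ℍ[K, (a : K), 0, (b : K)]) := by
  simp [normForm, QuadraticMap.weightedSumSquares_apply, Fin.sum_univ_four, nrd]
  ring

/-- Pure quaternions have scalar square, and a quaternion with scalar square is either pure or
scalar. So isomorphisms preserve pure quaternions, and the norm is read off from squares. -/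
theorem nrd_algHom (h2 : (2 : K) ≠ 0) {a b a' b' : K}
    (e : ℍ[K, a, 0, b] ≃ₐ[K] ℍ[K, a', 0, b']) (q : ℍ[K, a, 0, b]) : nrd (e q) = nrd q := by
  have pure : ∀ p : ℍ[K, a, 0, b], p.re = 0 → (e p).re = 0 ∧ nrd (e p) = nrd p := by
    intro p hp
    have hsq : e p * e p = algebraMap K _ (-nrd p) := by
      rw [← map_mul, mul_self_of_re_eq_zero hp, AlgEquiv.commutes]
    have hre : (e p).re = 0 := by
      by_contra hre
      have h' := QuaternionAlgebra.ext_iff.mp hsq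
      simp only [QuaternionAlgebra.imI_mul, QuaternionAlgebra.imJ_mul,
        QuaternionAlgebra.imK_mul, QuaternionAlgebra.algebraMap_eq] at h'
      have h2r := mul_ne_zero h2 hre
      have him : e p = algebraMap K _ (e p).re := by
        apply eq_algebraMap_of_im_eq_zero
        push Not
        refine ⟨mul_left_cancel₀ h2r ?_, mul_left_cancel₀ h2r ?_, mul_left_cancel₀ h2r ?_⟩
        · linear_combination h'.2.1
        · linear_combination h'.2.2.1
        · linear_combination h'.2.2.2
      rw [← e.commutes] at him
      have := congrArg QuaternionAlgebra.re (e.injective him)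
      rw [hp, QuaternionAlgebra.algebraMap_eq] at this
      exact hre this.symm
    refine ⟨hre, ?_⟩
    rw [mul_self_of_re_eq_zero hre] at hsq
    exact neg_injective (QuaternionAlgebra.algebraMap_injective hsq)
  have nrd_add : ∀ {c d : K} (r : K) (p : ℍ[K, c, 0, d]), p.re = 0 →
      nrd (algebraMap K _ r + p) = r ^ 2 + nrd p := by
    intro c d r p hp
    simp only [nrd, QuaternionAlgebra.algebraMap_eq, QuaternionAlgebra.re_add,
      QuaternionAlgebra.imI_add, QuaternionAlgebra.imJ_add, QuaternionAlgebra.imK_add, hp]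
    ring
  have hq : q = algebraMap K _ q.re + (q - algebraMap K _ q.re) := by abel
  have hp : (q - algebraMap K ℍ[K, a, 0, b] q.re).re = 0 := by
    simp [QuaternionAlgebra.algebraMap_eq]
  rw [hq, map_add, AlgEquiv.commutes, nrd_add _ _ (pure _ hp).1, nrd_add _ _ hp, (pure _ hp).2]

/-- The coordinates of a quaternion algebra. -/
def coordEquiv (a b : K) : ℍ[K, a, 0, b] ≃ₗ[K] (Fin 4 → K) :=
  QuaternionAlgebra.linearEquivTuple a 0 b

theorem normForm_coordEquiv (a b : Kˣ) (q : ℍ[K, (a : K), 0, (b : K)]) :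
    normForm a b (coordEquiv (a : K) (b : K) q) = nrd q := by
  rw [normForm_apply]
  rfl

/-- Isometry is defined through some choice of symbols; this makes it available for prescribed ones.
-/
theorem Isometric.exists_linearMap (h2 : (2 : K) ≠ 0) {D D' : Type v} [Ring D] [Algebra K D]
    [Ring D'] [Algebra K D'] (h : Isometric K D D') {a b a' b' : Kˣ} (hD : HasSymbol K D a b)
    (hD' : HasSymbol K D' a' b') :
    ∃ f : ℍ[K, (a : K), 0, (b : K)] →ₗ[K] ℍ[K, (a' : K), 0, (b' : K)], ∀ q, nrd (f q) = nrd q := by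
  obtain ⟨c, d, c', d', ⟨e₁⟩, ⟨e₁'⟩, ⟨g⟩⟩ := h
  obtain ⟨e⟩ := hD
  obtain ⟨e'⟩ := hD'
  refine ⟨(e₁'.symm.trans e').toLinearMap ∘ₗ (coordEquiv (c' : K) (d' : K)).symm.toLinearMap ∘ₗ
    g.toLinearEquiv.toLinearMap ∘ₗ (coordEquiv (c : K) (d : K)).toLinearMap ∘ₗ
    (e.symm.trans e₁).toLinearMap, fun q => ?_⟩
  simp only [LinearMap.comp_apply, AlgEquiv.toLinearMap_apply, LinearEquiv.coe_coe]
  rw [nrd_algHom h2, ← normForm_coordEquiv, LinearEquiv.apply_symm_apply]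
  refine (g.map_app _).trans ?_
  rw [normForm_coordEquiv, nrd_algHom h2]

theorem nrd_add_eq {a b : K} (p q : ℍ[K, a, 0, b]) :
    nrd (p + q) = nrd p + nrd q + 2 * (star p * q).re := by
  simp only [nrd, QuaternionAlgebra.re_add, QuaternionAlgebra.imI_add, QuaternionAlgebra.imJ_add,
    QuaternionAlgebra.imK_add, QuaternionAlgebra.re_mul, QuaternionAlgebra.re_star,
    QuaternionAlgebra.imI_star, QuaternionAlgebra.imJ_star, QuaternionAlgebra.imK_star]
  ring

/-- The element `p + i` intertwines `p` and i because both square to α. If it vanishes, j does so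
instead. -/
theorem exists_conj_i {α γ : K} {p : ℍ[K, α, 0, γ]} (hp : p * p = algebraMap K _ α) :
    ∃ z : ℍ[K, α, 0, γ], z ≠ 0 ∧ z * p = ⟨0, 1, 0, 0⟩ * z := by
  by_cases h : p + ⟨0, 1, 0, 0⟩ = 0
  · refine ⟨⟨0, 0, 1, 0⟩, fun h0 => by simpa using congrArg QuaternionAlgebra.imJ h0, ?_⟩
    rw [eq_neg_of_add_eq_zero_left h]
    ext <;> simp
  · refine ⟨_, h, ?_⟩
    rw [add_mul, mul_add, hp, add_comm]
    congr 1
    ext <;> simp [QuaternionAlgebra.algebraMap_eq]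

/-- If `(α, γ)` contains anticommuting square roots of `α` and `β`, then `(α, βγ)` splits. -/
theorem not_aniso_of_anticomm (h2 : (2 : K) ≠ 0) {α β γ : K} (hα : α ≠ 0)
    (hA : Aniso α γ) {p r : ℍ[K, α, 0, γ]} (hpre : p.re = 0)
    (hp : p * p = algebraMap K _ α) (hr : nrd r = -β) (hpr : p * r = -(r * p)) :
    ¬ Aniso α (β * γ) := by
  obtain ⟨z, hz, hzp⟩ := exists_conj_i hp
  have hnz : nrd z ≠ 0 := fun h => hz (hA z h)
  have hsp : star p = -p := by ext <;> simp [hpre]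
  have hpz : p * star z = star z * ⟨0, 1, 0, 0⟩ := by
    have := congrArg star hzp
    rw [star_mul, star_mul, hsp, neg_mul] at this
    have hi : star (⟨0, 1, 0, 0⟩ : ℍ[K, α, 0, γ]) = -⟨0, 1, 0, 0⟩ := by ext <;> simp
    rw [hi, mul_neg, neg_inj] at this
    exact this
  -- Conjugation by `z` carries `p` to i; up to a scalar it carries `r` to `z * r * star z`, which
  -- therefore anticommutes with i and lies in the span of j and k.
  have hanti : ⟨0, 1, 0, 0⟩ * (z * r * star z) = -(z * r * star z * ⟨0, 1, 0, 0⟩) := by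
    rw [mul_assoc _ (star z), ← hpz, ← mul_assoc, ← mul_assoc, ← hzp, mul_assoc z p r, hpr]
    simp only [mul_neg, neg_mul, mul_assoc]
  have hn : nrd (z * r * star z) = -β * nrd z ^ 2 := by
    rw [nrd_mul, nrd_mul, nrd_star, hr]
    ring
  obtain ⟨s, hs⟩ : ∃ s, s = z * r * star z := ⟨_, rfl⟩
  rw [← hs] at hanti hn
  have ha := QuaternionAlgebra.ext_iff.mp hanti
  simp only [QuaternionAlgebra.re_mul, QuaternionAlgebra.imI_mul, QuaternionAlgebra.imJ_mul,
    QuaternionAlgebra.imK_mul, QuaternionAlgebra.re_neg, QuaternionAlgebra.imI_neg] at ha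
  have hI : s.imI = 0 := by
    apply mul_left_cancel₀ (mul_ne_zero h2 hα)
    linear_combination ha.1
  have hR : s.re = 0 := by
    apply mul_left_cancel₀ h2
    linear_combination ha.2.1
  intro hB
  obtain ⟨N, hN⟩ : ∃ N, N = nrd z := ⟨_, rfl⟩
  rw [← hN] at hn hnz
  -- The norm of `s` gives γ(s_J² - αs_K²) = βN²; multiplying by γ yields this isotropic vector for
  -- (α, βγ).
  have := hB ⟨γ * s.imJ, γ * s.imK, N, 0⟩ (by
    rw [nrd, hI, hR] at hn
    simp only [nrd]
    linear_combination -γ * hn)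
  exact hnz (congrArg QuaternionAlgebra.imJ this)

/-- Multiplying by `star (f 1)` turns `f` into an isometry fixing 1. The images of i and j are then
pure and orthogonal, hence anticommute, with squares α and β. -/
theorem not_aniso_of_isometry (h2 : (2 : K) ≠ 0) {α β γ : K} (hα : α ≠ 0) (hA : Aniso α γ)
    (f : ℍ[K, α, 0, β] →ₗ[K] ℍ[K, α, 0, γ]) (hf : ∀ q, nrd (f q) = nrd q) :
    ¬ Aniso α (β * γ) := by
  have hf1 : nrd (f 1) = 1 := by rw [hf, nrd_one]
  have hN : ∀ q, nrd (star (f 1) * f q) = nrd q := fun q => by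
    rw [nrd_mul, nrd_star, hf1, hf, one_mul]
  have hB : ∀ p q, (star (f p) * f q).re = (star p * q).re := fun p q => by
    have h0 := hf (p + q)
    rw [map_add, nrd_add_eq, nrd_add_eq, hf, hf] at h0
    exact mul_left_cancel₀ h2 (add_left_cancel h0)
  have hi : (star (f 1) * f ⟨0, 1, 0, 0⟩).re = 0 := by rw [hB]; simp
  have hj : (star (f 1) * f ⟨0, 0, 1, 0⟩).re = 0 := by rw [hB]; simp
  have hij : (star (star (f 1) * f ⟨0, 1, 0, 0⟩) * (star (f 1) * f ⟨0, 0, 1, 0⟩)).re = 0 := by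
    rw [star_mul, star_star, mul_assoc, ← mul_assoc (f 1), mul_star_eq_nrd, hf1, map_one, one_mul,
      hB]
    simp
  have hni : nrd (star (f 1) * f ⟨0, 1, 0, 0⟩) = -α := by rw [hN]; simp [nrd]
  have hnj : nrd (star (f 1) * f ⟨0, 0, 1, 0⟩) = -β := by rw [hN]; simp [nrd]
  obtain ⟨p, hp⟩ : ∃ p, p = star (f 1) * f ⟨0, 1, 0, 0⟩ := ⟨_, rfl⟩
  obtain ⟨r, hr⟩ : ∃ r, r = star (f 1) * f ⟨0, 0, 1, 0⟩ := ⟨_, rfl⟩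
  rw [← hp] at hi hij hni
  rw [← hr] at hj hij hnj
  refine not_aniso_of_anticomm h2 hα hA hi ?_ hnj ?_ (p := p) (r := r)
  · rw [mul_self_of_re_eq_zero hi, hni, neg_neg]
  · simp only [QuaternionAlgebra.re_mul, QuaternionAlgebra.re_star,
      QuaternionAlgebra.imI_star, QuaternionAlgebra.imJ_star, QuaternionAlgebra.imK_star, hi, hj]
      at hij
    ext
    · simp [hi, hj]
      linear_combination -2 * hij
    · simp [hi, hj]; ring
    · simp [hi, hj]; ring
    · simp [hi, hj]; ring

theorem isometric_of_not_aniso (h2 : (2 : K) ≠ 0) {D D' : Type v} [Ring D] [Algebra K D]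
    [Ring D'] [Algebra K D'] {α β γ : Kˣ} (hD : HasSymbol K D α β) (hD' : HasSymbol K D' α γ)
    (hdiv : IsQuaternionDivision K D') (h : ¬ Aniso (α : K) ((β : K) * γ)) : Isometric K D D' := by
  have hA := (isQuaternionDivision_iff hD').mp hdiv
  obtain ⟨q, hq, hq0⟩ : ∃ q : ℍ[K, (α : K), 0, (β : K) * γ], nrd q = 0 ∧ q ≠ 0 := by
    simpa [Aniso] using h
  have hβ := β.ne_zero
  have hγ := γ.ne_zero
  have hn : q.imJ ^ 2 - α * q.imK ^ 2 ≠ 0 := by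
    intro h0
    have h1 : (⟨q.imJ, q.imK, 0, 0⟩ : ℍ[K, (α : K), 0, (γ : K)]) = 0 := hA _ (by
      simp only [nrd]; linear_combination h0)
    have h2 : (⟨q.re, q.imI, 0, 0⟩ : ℍ[K, (α : K), 0, (γ : K)]) = 0 := hA _ (by
      rw [nrd] at hq
      simp only [nrd]; linear_combination hq + β * γ * h0)
    rw [QuaternionAlgebra.ext_iff] at h1 h2
    exact hq0 (QuaternionAlgebra.ext h2.1 h2.2.1 h1.1 h1.2.1)
  obtain ⟨n, hn'⟩ : ∃ n, n = q.imJ ^ 2 - α * q.imK ^ 2 := ⟨_, rfl⟩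
  rw [← hn'] at hn
  -- This is γ⁻¹(q₀ + q₁i)(q₂ + q₃i)⁻¹j for the isotropic vector q: it anticommutes with i, and
  -- isotropy makes its square β. Thus (α, γ) also has the symbol (α, β).
  let r : ℍ[K, (α : K), 0, (γ : K)] := ⟨0, 0, (q.re * q.imJ - α * q.imI * q.imK) / (γ * n),
    (q.imI * q.imJ - q.re * q.imK) / (γ * n)⟩
  have hr : r * r = algebraMap K _ (β : K) := by
    rw [mul_self_of_re_eq_zero rfl]
    congr 1
    simp only [nrd, r]
    rw [nrd] at hq
    have hq' : q.re ^ 2 - α * q.imI ^ 2 = β * γ * n := by rw [hn']; linear_combination hq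
    field_simp
    have : (q.re ^ 2 - α * q.imI ^ 2) * (q.imJ ^ 2 - α * q.imK ^ 2) = β * γ * n * n := by
      rw [hq', ← hn']
    linear_combination this
  obtain ⟨e⟩ := id hD'
  have hr0 : r ≠ 0 := fun h0 => by
    rw [h0, mul_zero, eq_comm, map_eq_zero_iff _ QuaternionAlgebra.algebraMap_injective] at hr
    exact hβ hr
  obtain ⟨e', -⟩ := exists_algEquiv_of_anticomm (D := ℍ[K, (α : K), 0, (γ : K)]) h2
    ((isQuaternionDivision_iff ⟨AlgEquiv.refl⟩).mpr hA) (x := ⟨0, 1, 0, 0⟩) (z := r) (c := α) (f := β)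
    (fun s hs => by
      simpa [QuaternionAlgebra.algebraMap_eq] using congrArg QuaternionAlgebra.imI hs) hr0 (by
      ext <;> simp [QuaternionAlgebra.algebraMap_eq]) hr (by ext <;> simp [r])
  exact ⟨α, β, α, β, hD, ⟨e.trans e'⟩, QuadraticMap.Equivalent.refl _⟩

end Isometry

/-! ### Albert forms and the three properties of `L`. -/

section Main

variable {F : Type u} [Field F]

/-- The coefficients of the Albert form of the algebras `(a, b / F)` and `(a', b' / F)`. -/
def albertCoeff (a b a' b' : Fˣ) : Fin 6 → F :=
  ![-a, -b, a * b, a', b', -(a' * b')]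

theorem albertCoeff_ne_zero (a b a' b' : Fˣ) (i : Fin 6) : albertCoeff a b a' b' i ≠ 0 := by
  fin_cases i <;> simp [albertCoeff]

theorem sum_albertCoeff {L : Type*} [Field L] [Algebra F L] (a b a' b' : Fˣ) (z : Fin 6 → L) :
    ∑ i, algebraMap F L (albertCoeff a b a' b' i) * z i ^ 2 =
      nrd (⟨0, z 0, z 1, z 2⟩ : ℍ[L, algebraMap F L a, 0, algebraMap F L b]) -
        nrd (⟨0, z 3, z 4, z 5⟩ : ℍ[L, algebraMap F L a', 0, algebraMap F L b']) := by
  simp only [Fin.sum_univ_six, albertCoeff, nrd, Matrix.cons_val, map_neg, map_mul]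
  ring

/-- The isometry `⟨1, …⟩ ⊥ -⟨1, …⟩ ≅ ⟨…, -…⟩ ⊥ ⟨1, -1⟩`, as a permutation of the coordinates. -/
def albertEquiv (F : Type u) [Field F] :
    ((Fin 4 → F) × (Fin 4 → F)) ≃ₗ[F] ((Fin 6 → F) × (Fin 2 → F)) where
  toFun v := (![v.1 1, v.1 2, v.1 3, v.2 1, v.2 2, v.2 3], ![v.1 0, v.2 0])
  invFun v := (![v.2 0, v.1 0, v.1 1, v.1 2], ![v.2 1, v.1 3, v.1 4, v.1 5])
  map_add' u v := by
    ext i <;> fin_cases i <;> rfl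
  map_smul' r v := by
    ext i <;> fin_cases i <;> rfl
  left_inv v := by
    ext i <;> fin_cases i <;> rfl
  right_inv v := by
    ext i <;> fin_cases i <;> rfl

/-- A nontrivial zero would link the algebras by `linked_of_nrd_eq`; the two real coordinates form
the hyperbolic plane. -/
theorem isAnisotropicPart_albert (h2 : (2 : F) ≠ 0) (p : UnlinkedPair F) :
    IsAnisotropicPart p.1.1 p.1.2 (QuadraticMap.weightedSumSquares F
      (albertCoeff p.1.1.symbol.1 p.1.1.symbol.2 p.1.2.symbol.1 p.1.2.symbol.2)) := by
  obtain ⟨⟨D, D'⟩, hD, hD', hunl⟩ := p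
  refine ⟨fun v hv => ?_, ⟨{ albertEquiv F with map_app' := fun v => ?_ }⟩⟩
  · by_contra hv0
    have hs := sum_albertCoeff (L := F) D.symbol.1 D.symbol.2 D'.symbol.1 D'.symbol.2 v
    have hv' : ∑ i, algebraMap F F (albertCoeff D.symbol.1 D.symbol.2 D'.symbol.1 D'.symbol.2 i) *
        v i ^ 2 = 0 := by
      rw [← hv, QuadraticMap.weightedSumSquares_apply]
      simp [sq]
    rw [hv'] at hs
    refine hunl (linked_of_nrd_eq h2 (a := D.symbol.1) (b := D.symbol.2) (a' := D'.symbol.1)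
      (b' := D'.symbol.2) ⟨AlgEquiv.refl⟩ ⟨AlgEquiv.refl⟩ hD hD' rfl rfl
      (sub_eq_zero.mp hs.symm) ?_)
    by_contra! h0
    have h1 := QuaternionAlgebra.ext_iff.mp h0.1
    have h3 := QuaternionAlgebra.ext_iff.mp h0.2
    apply hv0
    ext i
    fin_cases i
    · exact h1.2.1
    · exact h1.2.2.1
    · exact h1.2.2.2
    · exact h3.2.1
    · exact h3.2.2.1
    · exact h3.2.2.2
  · change QuadraticMap.prod _ _ (albertEquiv F v) = _
    simp only [QuadraticMap.prod_apply, neg_apply, Quat.form, normForm,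
      QuadraticMap.weightedSumSquares_apply, Fin.sum_univ_four, Fin.sum_univ_six, Fin.sum_univ_two,
      albertEquiv, albertCoeff, LinearEquiv.coe_mk, LinearMap.coe_mk, AddHom.coe_mk, Matrix.cons_val,
      smul_eq_mul]
    ring

theorem Quat.hasSymbol_mk (a b : Fˣ) :
    HasSymbol F ℍ[F, (a : F), 0, (b : F)] (Quat.symbol (Quotient.mk (symbolSetoid F) (a, b))).1
      (Quat.symbol (Quotient.mk (symbolSetoid F) (a, b))).2 :=
  ((symbolSetoid F).symm (Quotient.mk_out (s := symbolSetoid F) (a, b)))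

theorem exists_quat {D : Type v} [Ring D] [Algebra F D] (hD : IsQuaternion F D) :
    ∃ Q : Quat F, HasSymbol F D Q.symbol.1 Q.symbol.2 := by
  obtain ⟨a, b, ⟨e⟩⟩ := hD
  exact ⟨Quotient.mk (symbolSetoid F) (a, b), (Quat.hasSymbol_mk a b).congr e.symm⟩

theorem exists_unlinkedPair (h2 : (2 : F) ≠ 0) {D D' : Type v} [Ring D] [Algebra F D] [Ring D']
    [Algebra F D'] (hD : IsQuaternionDivision F D) (hD' : IsQuaternionDivision F D')
    (h : ¬ Linked F D D') : ∃ p : UnlinkedPair F, HasSymbol F D p.1.1.symbol.1 p.1.1.symbol.2 ∧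
      HasSymbol F D' p.1.2.symbol.1 p.1.2.symbol.2 := by
  obtain ⟨Q, hQ⟩ := exists_quat hD.1
  obtain ⟨Q', hQ'⟩ := exists_quat hD'.1
  have hA : IsQuaternionDivision F Q.Alg :=
    (isQuaternionDivision_iff ⟨AlgEquiv.refl⟩).mpr ((isQuaternionDivision_iff hQ).mp hD)
  have hA' : IsQuaternionDivision F Q'.Alg :=
    (isQuaternionDivision_iff ⟨AlgEquiv.refl⟩).mpr ((isQuaternionDivision_iff hQ').mp hD')
  refine ⟨⟨(Q, Q'), hA, hA', fun hl => h ?_⟩, hQ, hQ'⟩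
  rw [linked_iff h2 hA hA'] at hl
  rw [linked_iff h2 hD hD']
  obtain ⟨c, f, f', h1, h1'⟩ := hl
  obtain ⟨e⟩ := hQ
  obtain ⟨e'⟩ := hQ'
  exact ⟨c, f, f', h1.congr e.symm, h1'.congr e'.symm⟩

/-- The coefficients of the Albert forms of the unlinked pairs. -/
noncomputable def pairCoeff (p : UnlinkedPair F) : Fin (5 + 1) → F :=
  albertCoeff p.1.1.symbol.1 p.1.1.symbol.2 p.1.2.symbol.1 p.1.2.symbol.2

variable {L : Type u} [Field L] [Algebra F L]

theorem GenericZeros.sum_eq_zero {P : Type u} {n : ℕ} {w : P → Fin (n + 1) → F}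
    (G : GenericZeros F L w) (hw : ∀ p i, w p i ≠ 0) (p : P) :
    ∑ i, algebraMap F L (w p i) * G.zero p i ^ 2 = 0 := by
  have hw' : algebraMap F L (w p 0) ≠ 0 := (map_ne_zero_iff _ (algebraMap F L).injective).mpr (hw p 0)
  have h0 : G.zero p 0 = G.y p := rfl
  have hs : ∀ i : Fin n, G.zero p i.succ = G.t (p, i) := fun i => rfl
  rw [Fin.sum_univ_succ, h0, G.sq_eq, Finset.mul_sum, ← Finset.sum_add_distrib]
  refine Finset.sum_eq_zero fun i _ => ?_
  rw [hs, map_neg, map_div₀]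
  field_simp
  ring

theorem isLinkingExtension (h2 : (2 : F) ≠ 0) (G : GenericZeros F L (pairCoeff (F := F))) :
    IsLinkingExtension F L := by
  intro D D' _ _ _ _ hD hD' hDL hDL'
  have h2L : (2 : L) ≠ 0 := by
    rw [← map_ofNat (algebraMap F L) 2]
    exact (map_ne_zero_iff _ (algebraMap F L).injective).mpr h2
  by_cases hl : Linked F D D'
  · obtain ⟨c, f, f', h, h'⟩ := (linked_iff h2 hD hD').mp hl
    exact (linked_iff h2L hDL hDL').mpr ⟨_, _, _, h.baseChange, h'.baseChange⟩
  · obtain ⟨p, h, h'⟩ := exists_unlinkedPair h2 hD hD' hl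
    have hz := G.sum_eq_zero (fun p => albertCoeff_ne_zero _ _ _ _) p
    have hz' := (sum_albertCoeff _ _ _ _ _).symm.trans hz
    refine linked_of_nrd_eq h2L h.baseChange h'.baseChange hDL hDL' rfl rfl (sub_eq_zero.mp hz')
      (Or.inl fun h0 => ?_)
    -- The zero is nontrivial because its second coordinate is transcendental.
    have h1 : G.t (p, 0) = 0 := congrArg QuaternionAlgebra.imJ h0
    exact (G.algebraicIndependent.transcendental (p, 0)) (h1 ▸ isAlgebraic_zero)

theorem isFunctionFieldTower (h2 : (2 : F) ≠ 0) (G : GenericZeros F L (pairCoeff (F := F)))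
    (htop : G.field Set.univ = ⊤) : IsFunctionFieldTower F L := by
  have hw : ∀ (p : UnlinkedPair F) i, pairCoeff p i ≠ 0 := fun p => albertCoeff_ne_zero _ _ _ _
  have hwo : IsWellOrder (UnlinkedPair F) WellOrderingRel := inferInstance
  refine ⟨WellOrderingRel, fun p => QuadraticMap.weightedSumSquares F (pairCoeff p),
    fun p => G.field (insert p {p' | WellOrderingRel p' p}), hwo,
    isAnisotropicPart_albert h2, fun p => ?_, ?_⟩
  -- The first algebra of the pair itself remains division over `L`, and so over each field below;
  -- it is the auxiliary witness needed for the function field.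
  · have hA : Aniso (p.1.1.symbol.1 : F) (p.1.1.symbol.2 : F) :=
      (isQuaternionDivision_iff ⟨AlgEquiv.refl⟩).mp p.2.1
    refine G.exists_algEquiv_bigFunctionField h2 (Units.ne_zero _) (Units.ne_zero _)
      (G.aniso h2 (Units.ne_zero _) (Units.ne_zero _) hA (by norm_num) hw htop) (by norm_num) hw
      (A := {p' | WellOrderingRel p' p}) (fun h => irrefl_of WellOrderingRel p h) ?_ rfl
    refine G.biUnion_field {p' | WellOrderingRel p' p} (fun p => insert p {p' | WellOrderingRel p' p})
      (fun q _ => Set.mem_insert _ _) fun q hq r hr => ?_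
    rcases hr with rfl | hr
    · exact hq
    · exact trans_of WellOrderingRel hr hq
  · rw [← htop, ← G.biUnion_field Set.univ (fun p => insert p {p' | WellOrderingRel p' p})
      (fun q _ => Set.mem_insert _ _) fun _ _ => Set.subset_univ _]
    exact (Equiv.Set.univ _).iSup_congr (fun _ => rfl) |>.symm

/-- The three algebras (α, β), (α, γ) and (α, βγ) are division over `F`, hence over `L`; the third
obstructs isometry. -/
theorem division_and_not_isometric (h2 : (2 : F) ≠ 0)
    (hL : ∀ a b : F, a ≠ 0 → b ≠ 0 → Aniso a b → Aniso (algebraMap F L a) (algebraMap F L b))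
    (D D' : Type u) [Ring D] [Algebra F D] [Ring D'] [Algebra F D'] (hD : IsQuaternionDivision F D)
    (hD' : IsQuaternionDivision F D') (hl : Linked F D D') (hi : ¬ Isometric F D D') :
    IsQuaternionDivision L (L ⊗[F] D) ∧ IsQuaternionDivision L (L ⊗[F] D') ∧
      ¬ Isometric L (L ⊗[F] D) (L ⊗[F] D') := by
  have h2L : (2 : L) ≠ 0 := by
    rw [← map_ofNat (algebraMap F L) 2]
    exact (map_ne_zero_iff _ (algebraMap F L).injective).mpr h2
  obtain ⟨α, β, γ, h, h'⟩ := (linked_iff h2 hD hD').mp hl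
  have hβγ : Aniso (α : F) ((β : F) * γ) := by
    by_contra hn
    exact hi (isometric_of_not_aniso h2 h h' hD' hn)
  have hA := hL _ _ α.ne_zero β.ne_zero ((isQuaternionDivision_iff h).mp hD)
  have hA' := hL _ _ α.ne_zero γ.ne_zero ((isQuaternionDivision_iff h').mp hD')
  have hA'' := hL _ _ α.ne_zero (mul_ne_zero β.ne_zero γ.ne_zero) hβγ
  refine ⟨(isQuaternionDivision_iff h.baseChange).mpr hA,
    (isQuaternionDivision_iff h'.baseChange).mpr hA', fun hiso => ?_⟩
  obtain ⟨f, hf⟩ := hiso.exists_linearMap h2L h.baseChange h'.baseChange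
  rw [map_mul] at hA''
  exact not_aniso_of_isometry h2L (Units.ne_zero _) hA' f hf hA''

end Main

end Linking

theorem proposition4p1 (F : Type u) [Field F] (hF : ringChar F ≠ 2) :
    ∃ (L : Type u) (_ : Field L) (_ : Algebra F L),
      Linking.IsLinkingExtension F L ∧
      (∀ (D D' : Type u) [Ring D] [Algebra F D] [Ring D'] [Algebra F D'],
        Linking.IsQuaternionDivision F D → Linking.IsQuaternionDivision F D' →
        Linking.Linked F D D' → ¬ Linking.Isometric F D D' →
        Linking.IsQuaternionDivision L (L ⊗[F] D) ∧
        Linking.IsQuaternionDivision L (L ⊗[F] D') ∧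
        ¬ Linking.Isometric L (L ⊗[F] D) (L ⊗[F] D')) ∧
      Linking.IsFunctionFieldTower F L := by
  have h2 : (2 : F) ≠ 0 := Ring.two_ne_zero hF
  obtain ⟨L, _, _, G, htop⟩ := Linking.exists_genericZeros (Linking.pairCoeff (F := F))
  exact ⟨L, inferInstance, inferInstance, Linking.isLinkingExtension h2 G,
    Linking.division_and_not_isometric h2 fun a b ha hb h => G.aniso h2 ha hb h (by norm_num)
      (fun p => Linking.albertCoeff_ne_zero _ _ _ _) htop,
    Linking.isFunctionFieldTower h2 G htop⟩
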